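/- Let $G=(V,E)$ be a connected finite simple graph with edge weights $\omega\colon E\to\mathbb N$. A *TSP tour* of a graph is a closed walk containing all its vertices; its weight is the sum of the weights of its edges, counted with multiplicity. For $\alpha\ge 1$, a TSP tour is *$\alpha$-approximate* if its weight is at most $\alpha$ times the minimum weight of a TSP tour, and *optimal* if it has minimum weight. For a vertex $s$ let $\omega_{\min}(s)=\min_{w\in N(s)}\omega(\{s,w\})$. *Reduction.* Let $C\subseteq V$ be a vertex cover of $G$. The *hop graph* $H$ is the bipartite graph with sides $X=\{(u,v)\in C\times C: u\neq v\}$ and $Y=V\setminus C$, in which $(u,v)\in X$ and $s\in Y$ are adjacent iff $s\in N(u)\cap N(v)$, and this edge has cost $\omega(\{u,s\})+\omega(\{s,v\})-2\omega_{\min}(s)$. Let $M^*$ be a maximum-cardinality matching of $H$ that has minimum cost among all maximum-cardinality matchings, and let $S\subseteq Y$ be the set of vertices of $Y$ matched by $M^*$. The reduced instance $(G',\omega')$ is obtained from $(G,\omega)$ by deleting all vertices outside $C\cup S$. Its vertex set depends on the choices of $C$ and $M^*$; the following holds for every choice. 1. If $|V|\ge 2$, then $G$ has an optimal TSP tour that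 traverses all deleted vertices by loops: each $s\in V\setminus(C\cup S)$ lies on the tour, and whenever the (cyclically read) tour traverses $s$, it does so via a subwalk of the form $(w,s,w)$. 2. The kernel is $1$-approximate: there is a polynomial-time algorithm that, given $(G,\omega)$, the reduced instance $(G',\omega')$ and any TSP tour $P'$ of $G'$, outputs a TSP tour $P$ of $G$ such that, for every real $\alpha\ge1$, if $P'$ is $\alpha$-approximate for $(G',\omega')$, then $P$ is $\alpha$-approximate for $(G,\omega)$. The tour $P$ arises from $P'$ by adding, for each deleted vertex $s\in V\setminus(C\cup S)$, exactly one loop $(w,s,w)$ with $w\in N(s)$ and $\omega(\{s,w\})=\omega_{\min}(s)$, so that $$\omega(P)=\omega'(P')+2\sum_{s\in V\setminus(C\cup S)}\omega_{\min}(s).$$ -/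

import Mathlib

namespace GTSP

/-! ### Walks, TSP tours, approximation -/

section Tours

variable {V : Type*} {G : SimpleGraph V}

/-- The weight of a walk: the sum of the weights of its edges, with multiplicity.  Only the values
of `ω` on edges of `G` matter. -/
def walkWeight (ω : Sym2 V → ℕ) {u v : V} (p : G.Walk u v) : ℕ :=
  (p.edges.map ω).sum

/-- A TSP tour of `G` is a closed walk that contains every vertex of `G`. -/
def IsTour {v : V} (p : G.Walk v v) : Prop :=
  ∀ u : V, u ∈ p.support

/-- A TSP tour of minimum weight. -/
def IsOptimalTour (ω : Sym2 V → ℕ) {v : V} (p : G.Walk v v) : Prop :=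
  IsTour p ∧ ∀ (u : V) (q : G.Walk u u), IsTour q → walkWeight ω p ≤ walkWeight ω q

/-- A TSP tour whose weight exceeds the minimum weight of a TSP tour by at most a factor `α`. -/
def IsApproxTour (ω : Sym2 V → ℕ) (α : ℝ) {v : V} (p : G.Walk v v) : Prop :=
  IsTour p ∧ ∀ (u : V) (q : G.Walk u u), IsTour q →
    (walkWeight ω p : ℝ) ≤ α * (walkWeight ω q : ℝ)

/-- `(a, s, b)` is a subwalk of the closed walk `p`, which is read cyclically: it may run across
the base point of `p`, so it is looked up in `p ∘ p`. -/
def Traverses {v : V} (p : G.Walk v v) (a s b : V) : Prop :=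
  [a, s, b] <:+: (p.append p).support

/-- The closed walk `p` traverses `s`, and every time it does so by a loop `(w, s, w)`, never by a
hop `(a, s, b)` with `a ≠ b`. -/
def TraversesByLoops {v : V} (p : G.Walk v v) (s : V) : Prop :=
  (∃ w, Traverses p w s w) ∧ ∀ a b, Traverses p a s b → a = b

end Tours

/-! ### The hop graph and the data reduction rule -/

section Reduction

variable {V : Type*}

/-- The minimum weight of an edge incident to `s` (it is only used if `s` has a neighbor). -/
noncomputable def minWeight (G : SimpleGraph V) (ω : Sym2 V → ℕ) (s : V) : ℕ :=
  sInf ((fun w => ω s(s, w)) '' G.neighborSet s)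

/-- The edges of the hop graph for `G` and `C`, a bipartite graph with sides
`X = {(u, v) ∈ C × C | u ≠ v}` and `Y = V \ C`.  The edge between `(u, v) ∈ X` and `y ∈ Y` is
written as the pair `((u, v), y)`. -/
def hopEdges (G : SimpleGraph V) (C : Finset V) : Set ((V × V) × V) :=
  {e | e.1.1 ∈ C ∧ e.1.2 ∈ C ∧ e.1.1 ≠ e.1.2 ∧ e.2 ∉ C ∧ G.Adj e.1.1 e.2 ∧ G.Adj e.1.2 e.2}

/-- The cost of an edge of the hop graph. -/
noncomputable def hopCost (G : SimpleGraph V) (ω : Sym2 V → ℕ) (e : (V × V) × V) : ℤ :=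
  (ω s(e.1.1, e.2) : ℤ) + (ω s(e.2, e.1.2) : ℤ) - 2 * (minWeight G ω e.2 : ℤ)

/-- A matching of the hop graph: a set of edges, no two of which share an endpoint in `X` or in
`Y`. -/
def IsHopMatching (G : SimpleGraph V) (C : Finset V) (M : Finset ((V × V) × V)) : Prop :=
  (∀ e ∈ M, e ∈ hopEdges G C) ∧ ∀ e ∈ M, ∀ f ∈ M, e.1 = f.1 ∨ e.2 = f.2 → e = f

/-- A maximum-cardinality matching of the hop graph that has minimum cost among all
maximum-cardinality matchings. -/
def IsMinCostMaxHopMatching (G : SimpleGraph V) (ω : Sym2 V → ℕ) (C : Finset V)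
    (M : Finset ((V × V) × V)) : Prop :=
  IsHopMatching G C M ∧
  (∀ M', IsHopMatching G C M' → M'.card ≤ M.card) ∧
  ∀ M', IsHopMatching G C M' → M'.card = M.card →
    ∑ e ∈ M, hopCost G ω e ≤ ∑ e ∈ M', hopCost G ω e

/-- The vertices `C ∪ S` that the reduction keeps, where `S` is the set of vertices of `V \ C`
matched by `M`. -/
def kept [DecidableEq V] (C : Finset V) (M : Finset ((V × V) × V)) : Finset V :=
  C ∪ M.image Prod.snd

/-- The graph `G - (V \ K)`, obtained by deleting all vertices outside `K`. -/
abbrev reducedGraph (G : SimpleGraph V) (K : Finset V) : SimpleGraph (K : Set V) :=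
  G.induce (K : Set V)

/-- The restriction of the weights to the reduced graph. -/
def reducedWeight (ω : Sym2 V → ℕ) (K : Finset V) : Sym2 (K : Set V) → ℕ :=
  fun e => ω (e.map Subtype.val)

/-- `AddsCheapestLoops G ω p D q`: the vertex sequence `q` arises from the vertex sequence `p` by
adding, for each entry `s` of the list `D` one after the other, one loop `(w, s, w)` at some
occurrence of a neighbor `w` of `s` for which the weight of `{s, w}` is minimum. -/
inductive AddsCheapestLoops (G : SimpleGraph V) (ω : Sym2 V → ℕ) :
    List V → List V → List V → Prop
  | nil (p : List V) : AddsCheapestLoops G ω p [] p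
  | cons (p₁ p₂ : List V) (w s : V) (D q : List V) :
      G.Adj s w → ω s(s, w) = minWeight G ω s →
      AddsCheapestLoops G ω (p₁ ++ w :: s :: w :: p₂) D q →
      AddsCheapestLoops G ω (p₁ ++ w :: p₂) (s :: D) q

end Reduction

/-! ### Random access machines

Structured programs for a random access machine with registers and arrays that hold natural
numbers, under the uniform cost measure.  The only arithmetic is addition and truncated
subtraction, so that in each step the bit length of the largest number grows by at most one; such
machines and Turing machines simulate each other with polynomial overhead. -/

section Machine

/-- Contents of the registers, `reg r`, and of the arrays, `arr a i`. -/
structure State where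
  reg : ℕ → ℕ
  arr : ℕ → ℕ → ℕ

/-- Write `k` to register `r`. -/
def State.setReg (σ : State) (r k : ℕ) : State :=
  { σ with reg := Function.update σ.reg r k }

/-- Write `k` to cell `i` of array `a`. -/
def State.setArr (σ : State) (a i k : ℕ) : State :=
  { σ with arr := Function.update σ.arr a (Function.update (σ.arr a) i k) }

/-- Programs.  Register names, array names and the constants of `const` are fixed in the program;
array indices are read from registers. -/
inductive Prog where
  | skip : Prog
  | const (r k : ℕ) : Prog
  | add (r x y : ℕ) : Prog
  | sub (r x y : ℕ) : Prog
  | load (r a i : ℕ) : Prog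
  | store (a i x : ℕ) : Prog
  | seq (c d : Prog) : Prog
  | ite (x : ℕ) (c d : Prog) : Prog
  | loop (x : ℕ) (c : Prog) : Prog

/-- `Runs c σ σ' t`: the program `c`, started in state `σ`, halts in state `σ'` after `t` steps.
An elementary instruction takes one step, and so does each test of a register against zero;
`ite x c d` runs `c` if register `x` is nonzero and `d` otherwise, and `loop x c` repeats `c` while
register `x` is nonzero. -/
inductive Runs : Prog → State → State → ℕ → Prop
  | skip (σ : State) : Runs .skip σ σ 1
  | const (r k : ℕ) (σ : State) : Runs (.const r k) σ (σ.setReg r k) 1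
  | add (r x y : ℕ) (σ : State) : Runs (.add r x y) σ (σ.setReg r (σ.reg x + σ.reg y)) 1
  | sub (r x y : ℕ) (σ : State) : Runs (.sub r x y) σ (σ.setReg r (σ.reg x - σ.reg y)) 1
  | load (r a i : ℕ) (σ : State) : Runs (.load r a i) σ (σ.setReg r (σ.arr a (σ.reg i))) 1
  | store (a i x : ℕ) (σ : State) : Runs (.store a i x) σ (σ.setArr a (σ.reg i) (σ.reg x)) 1
  | seq {c d : Prog} {σ σ₁ σ₂ : State} {t₁ t₂ : ℕ} :
      Runs c σ σ₁ t₁ → Runs d σ₁ σ₂ t₂ → Runs (.seq c d) σ σ₂ (t₁ + t₂)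
  | ite_true {x : ℕ} {c d : Prog} {σ σ' : State} {t : ℕ} :
      σ.reg x ≠ 0 → Runs c σ σ' t → Runs (.ite x c d) σ σ' (t + 1)
  | ite_false {x : ℕ} {c d : Prog} {σ σ' : State} {t : ℕ} :
      σ.reg x = 0 → Runs d σ σ' t → Runs (.ite x c d) σ σ' (t + 1)
  | loop_done {x : ℕ} {c : Prog} {σ : State} :
      σ.reg x = 0 → Runs (.loop x c) σ σ 1
  | loop_step {x : ℕ} {c : Prog} {σ σ₁ σ₂ : State} {t₁ t₂ : ℕ} :
      σ.reg x ≠ 0 → Runs c σ σ₁ t₁ → Runs (.loop x c) σ₁ σ₂ t₂ →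
      Runs (.loop x c) σ σ₂ (t₁ + t₂ + 1)

/-- The initial state on input `[a₁, …, aₖ]`: the list `aᵢ` stands in array `i` and its length in
register `i`, and everything else is `0`. -/
def initialState (input : List (List ℕ)) : State where
  reg r := if r = 0 then 0 else (input.getD (r - 1) []).length
  arr a i := if a = 0 then 0 else (input.getD (a - 1) []).getD i 0

/-- The output of a final state: the first `m` cells of array `0`, where `m` is the content of
register `0`. -/
def State.output (σ : State) : List ℕ :=
  (List.range (σ.reg 0)).map (σ.arr 0)

/-- The size of an input: the total length of the binary representations of its numbers, plus the
number of numbers. -/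
def inputSize (input : List (List ℕ)) : ℕ :=
  (input.map fun a => (a.map fun x => Nat.size x + 1).sum).sum

/-- On the given input, the program `c` halts after at most `T` steps with the given output. -/
def ComputesWithin (c : Prog) (input : List (List ℕ)) (output : List ℕ) (T : ℕ) : Prop :=
  ∃ (σ : State) (t : ℕ), Runs c (initialState input) σ t ∧ t ≤ T ∧ σ.output = output

end Machine

/-! ### Encoding of the instances and of the tour -/

section Encoding

variable {n : ℕ}

open Classical in
/-- The weighted adjacency matrix of `(G, ω)`, row by row: the entry for `(i, j)` is `0` if
`{i, j}` is not an edge, and `ω {i, j} + 1` if it is. -/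
noncomputable def encodeGraph (G : SimpleGraph (Fin n)) (ω : Sym2 (Fin n) → ℕ) : List ℕ :=
  (List.finRange n).flatMap fun i =>
    (List.finRange n).map fun j => if G.Adj i j then ω s(i, j) + 1 else 0

/-- The characteristic vector of the vertex set `K` of the reduced graph; along with `(G, ω)` it
determines the reduced instance, which is the restriction of `(G, ω)` to `K`. -/
def encodeKept (K : Finset (Fin n)) : List ℕ :=
  (List.finRange n).map fun i => if i ∈ K then 1 else 0

/-- The input of the lifting algorithm: the original instance, the reduced instance, and a tour of
the reduced graph as the sequence of its vertices. -/
noncomputable def liftInput (G : SimpleGraph (Fin n)) (ω : Sym2 (Fin n) → ℕ) (K : Finset (Fin n))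
    {u : (K : Set (Fin n))} (p : (reducedGraph G K).Walk u u) : List (List ℕ) :=
  [encodeGraph G ω, encodeKept K, p.support.map fun v => v.val.val]

end Encoding

end GTSP

/-!
Fix a vertex cover `C`.  The vertices outside `C` are independent, so a closed walk based in `C` is
a *route*: a sequence of steps between vertices of `C`, each along an edge or through one vertex
outside `C` (`exists_route_of_walk`, `IsRoute.exists_walk`).  The cost of a route is its weight plus
that of a cheapest loop to each vertex outside `C` that it misses.  Three operations do not increase
this cost, and each lowers the number of visits outside `C`, or keeps it and lowers the number of
such visits to vertices that the matching `M` leaves free: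

* leaving out a step that is a loop (`exists_route_of_loop`);
* replacing two hops over the same ordered pair `(u, v)` by loops, where the part of the route
  between them is reversed so that the route stays closed (`exists_route_of_parallel`);
* if there are neither loops nor such parallel hops, and a vertex `s` that `M` leaves free is hopped
  through, exchanging the hops along the alternating path that starts at `s`
  (`exists_route_of_free`).  Since `M` has maximum cardinality, the path ends at a vertex that is
  not yet hopped through; since `M` has minimum cost, the exchange does not raise the cost of the
  route.  As hops are exchanged by renaming the middle vertices of steps, the route stays closed,
  even if a vertex is hopped through several times.

So every tour of `G` yields a closed walk on exactly the kept vertices that, together with a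
cheapest loop to each deleted vertex, is no heavier (`exists_walk_on_kept`).  Applied to an optimal
tour this gives the first claim.  It also shows that the optimum of `G` exceeds that of the reduced
graph by at least the weight of these loops, so adding them to an `α`-approximate tour of the
reduced graph gives an `α`-approximate tour of `G` (`IsApproxTour.lift`).

The loops are added by `liftProg`: after each vertex `v` of the given tour it appends a loop to each
vertex that is not yet present and for which `v` is a cheapest neighbor.  Its correctness and cubic
running time are proved with loop invariants (`Halts.loop`, `computesWithin_liftProg`).
-/

namespace GTSP

/-! ### Exchange along an alternating path -/

/-- A set of pairs, no two of which share a component. -/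
def IsPairMatching {X Y : Type*} (M : Finset (X × Y)) : Prop :=
  ∀ e ∈ M, ∀ f ∈ M, e.1 = f.1 ∨ e.2 = f.2 → e = f

/-- Exchange along the alternating path of an element `s` that is covered by `F` but left free by
`M`.  Here `M` is a maximum-cardinality matching of minimum cost, while `F` may use second
components several times.  The pairs in `A ⊆ F` have partners in `M` with the same first components,
given by `μ`.  Replacing `A` by these partners does not raise the cost; it may uncover only `s`, and
it covers one new element `t`.

No path is constructed: `A` and its partners are read off from the set `O` of all elements that are
reachable from `s` along pairs of `F` and `M` in turn, where for each element one pair of `F` is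
chosen. -/
theorem exists_matching_exchange {X Y : Type*} [DecidableEq X] [DecidableEq Y] [Finite Y]
    (E : Set (X × Y)) (c : X × Y → ℤ) (M F : Finset (X × Y)) (hME : ∀ e ∈ M, e ∈ E)
    (hM : IsPairMatching M)
    (hmax : ∀ M' : Finset (X × Y), (∀ e ∈ M', e ∈ E) → IsPairMatching M' → M'.card ≤ M.card)
    (hmin : ∀ M' : Finset (X × Y), (∀ e ∈ M', e ∈ E) → IsPairMatching M' → M'.card = M.card →
      ∑ e ∈ M, c e ≤ ∑ e ∈ M', c e)
    (hFE : ∀ e ∈ F, e ∈ E) (hF : ∀ e ∈ F, ∀ f ∈ F, e.1 = f.1 → e = f)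
    (s : Y) (hsF : s ∈ F.image Prod.snd) (hsM : s ∉ M.image Prod.snd) :
    ∃ (μ : X → Y) (A : Finset (X × Y)) (t : Y), A ⊆ F ∧ (∀ e ∈ A, (e.1, μ e.1) ∈ M) ∧
      (∃ e ∈ A, e.2 = s) ∧ t ∉ F.image Prod.snd ∧ t ≠ s ∧
      (∀ y, y ∈ F.image Prod.snd ∨ y = t → y ≠ s →
        (∃ e ∈ F, e ∉ A ∧ e.2 = y) ∨ ∃ e ∈ A, μ e.1 = y) ∧
      ∑ e ∈ A, c (e.1, μ e.1) ≤ ∑ e ∈ A, c e ∧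
      ∀ f : Y → ℤ, ∑ e ∈ A, f (μ e.1) + f s = ∑ e ∈ A, f e.2 + f t := by
  classical
  have : Fintype Y := Fintype.ofFinite Y
  have : Nonempty Y := ⟨s⟩
  obtain ⟨e₀, he₀, -⟩ := Finset.mem_image.1 hsF
  have : Nonempty X := ⟨e₀.1⟩
  have hμ' : ∀ x, ∃ y, x ∈ M.image Prod.fst → (x, y) ∈ M := by
    intro x
    by_cases hx : x ∈ M.image Prod.fst
    · obtain ⟨e, he, rfl⟩ := Finset.mem_image.1 hx
      exact ⟨e.2, fun _ => he⟩
    · exact ⟨s, fun h => absurd h hx⟩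
  choose μ hμ using hμ'
  have hρ' : ∀ y, ∃ x, y ∈ F.image Prod.snd → (x, y) ∈ F := by
    intro y
    by_cases hy : y ∈ F.image Prod.snd
    · obtain ⟨e, he, rfl⟩ := Finset.mem_image.1 hy
      exact ⟨e.1, fun _ => he⟩
    · exact ⟨e₀.1, fun h => absurd h hy⟩
  choose ρ hρ using hρ'
  let r : Y → Y → Prop := fun y z => y ∈ F.image Prod.snd ∧ (ρ y, z) ∈ M
  let O : Finset Y := Finset.univ.filter fun y => Relation.ReflTransGen r s y
  have hsO : s ∈ O := by simp [O, Relation.ReflTransGen.refl]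
  have hstep : ∀ y ∈ O, y ∈ F.image Prod.snd → ∀ z, (ρ y, z) ∈ M → z ∈ O := by
    intro y hy hyF z hz
    simp only [O, Finset.mem_filter, Finset.mem_univ, true_and] at hy ⊢
    exact hy.tail ⟨hyF, hz⟩
  have hpre : ∀ z ∈ O, z ≠ s → ∃ y ∈ O, y ∈ F.image Prod.snd ∧ (ρ y, z) ∈ M := by
    intro z hz hzs
    simp only [O, Finset.mem_filter, Finset.mem_univ, true_and] at hz
    rcases Relation.ReflTransGen.cases_tail hz with h | ⟨y, hy, hyF, hyM⟩
    · exact absurd h hzs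
    · exact ⟨y, by simpa [O] using hy, hyF, hyM⟩
  let L : Finset Y := O.filter fun y => y ∈ F.image Prod.snd
  have hLO : L ⊆ O := Finset.filter_subset _ _
  have hLF : ∀ y ∈ L, (ρ y, y) ∈ F := fun y hy => hρ y (Finset.mem_filter.1 hy).2
  let A : Finset (X × Y) := L.image fun y => (ρ y, y)
  let B : Finset (X × Y) := M.filter fun e => e.1 ∈ A.image Prod.fst
  have hsL : s ∈ L := Finset.mem_filter.2 ⟨hsO, hsF⟩
  have hAF : A ⊆ F := by
    intro e he
    obtain ⟨y, hy, rfl⟩ := Finset.mem_image.1 he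
    exact hLF y hy
  have hAcard : A.card = L.card :=
    Finset.card_image_of_injOn fun y _ z _ h => congrArg Prod.snd h
  have hBsnd : B.image Prod.snd = O.erase s := by
    ext z
    simp only [Finset.mem_image, Finset.mem_erase, B, A, Finset.mem_filter]
    constructor
    · rintro ⟨e, ⟨heM, f, ⟨y, hy, rfl⟩, hye⟩, rfl⟩
      refine ⟨?_, hstep y (hLO hy) (Finset.mem_filter.1 hy).2 _ (by rwa [show (ρ y, e.2) = e from Prod.ext hye rfl])⟩
      rintro rfl
      exact hsM (Finset.mem_image_of_mem _ heM)
    · rintro ⟨hzs, hz⟩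
      obtain ⟨y, hy, hyF, hyM⟩ := hpre z hz hzs
      exact ⟨(ρ y, z), ⟨hyM, (ρ y, y), ⟨y, Finset.mem_filter.2 ⟨hy, hyF⟩, rfl⟩, rfl⟩, rfl⟩
  have hBM : B ⊆ M := Finset.filter_subset _ _
  have hBcard : B.card = O.card - 1 := by
    rw [← Finset.card_erase_of_mem hsO, ← hBsnd, Finset.card_image_of_injOn]
    intro e he f hf h
    exact hM e (hBM he) f (hBM hf) (Or.inr h)
  have hAfst : (A.image Prod.fst).card = A.card :=
    Finset.card_image_of_injOn fun e he f hf h => hF e (hAF he) f (hAF hf) h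
  have hBfst : (B.image Prod.fst).card = B.card :=
    Finset.card_image_of_injOn fun e he f hf h => hM e (hBM he) f (hBM hf) (Or.inl h)
  have hBA : B.image Prod.fst ⊆ A.image Prod.fst := by
    intro x hx
    obtain ⟨e, he, rfl⟩ := Finset.mem_image.1 hx
    exact (Finset.mem_filter.1 he).2
  -- Exchanging `B` for `A` turns `M` into another matching, as the components of `A` are those of
  -- `B` and possibly `s`, which `M` leaves free.
  have hcross : ∀ e ∈ M \ B, ∀ f ∈ A, ¬ (e.1 = f.1 ∨ e.2 = f.2) := by
    intro e he f hf h
    obtain ⟨heM, heB⟩ := Finset.mem_sdiff.1 he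
    rcases h with h | h
    · exact heB (Finset.mem_filter.2 ⟨heM, h ▸ Finset.mem_image_of_mem _ hf⟩)
    · obtain ⟨y, hy, rfl⟩ := Finset.mem_image.1 hf
      by_cases hys : y = s
      · exact hsM (Finset.mem_image.2 ⟨e, heM, h.trans hys⟩)
      · have : y ∈ B.image Prod.snd := hBsnd ▸ Finset.mem_erase.2 ⟨hys, hLO hy⟩
        obtain ⟨g, hg, hgy⟩ := Finset.mem_image.1 this
        exact heB ((hM e heM g (hBM hg) (Or.inr (h.trans hgy.symm))) ▸ hg)
  have hdisj : Disjoint (M \ B) A :=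
    Finset.disjoint_left.2 fun e he heA => hcross e he e heA (Or.inl rfl)
  have hM'E : ∀ e ∈ (M \ B) ∪ A, e ∈ E := by
    intro e he
    rcases Finset.mem_union.1 he with h | h
    · exact hME e (Finset.sdiff_subset h)
    · exact hFE e (hAF h)
  have hM' : IsPairMatching ((M \ B) ∪ A) := by
    intro e he f hf h
    rcases Finset.mem_union.1 he with h₁ | h₁ <;> rcases Finset.mem_union.1 hf with h₂ | h₂
    · exact hM e (Finset.sdiff_subset h₁) f (Finset.sdiff_subset h₂) h
    · exact absurd h (hcross e h₁ f h₂)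
    · exact absurd (h.imp Eq.symm Eq.symm) (hcross f h₂ e h₁)
    · rcases h with h | h
      · exact hF e (hAF h₁) f (hAF h₂) h
      · obtain ⟨y, hy, rfl⟩ := Finset.mem_image.1 h₁
        obtain ⟨z, hz, rfl⟩ := Finset.mem_image.1 h₂
        obtain rfl : y = z := h
        rfl
  have hcard : ((M \ B) ∪ A).card + B.card = M.card + A.card := by
    rw [Finset.card_union_of_disjoint hdisj]
    have := Finset.card_sdiff_add_card_eq_card hBM
    omega
  -- Maximality of `M` leaves no room for a further edge in `A`, so `A` and `B` use the same first
  -- components and exactly one element `t` of `O` is not covered by `F`.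
  have h1 := hmax _ hM'E hM'
  have h2 : B.card ≤ A.card := by
    rw [← hAfst, ← hBfst]; exact Finset.card_le_card hBA
  have hfst : B.image Prod.fst = A.image Prod.fst :=
    Finset.eq_of_subset_of_card_le hBA (by omega)
  have hcost := hmin _ hM'E hM' (by omega)
  rw [Finset.sum_union hdisj, ← Finset.sum_sdiff hBM] at hcost
  have hOcard : (O \ L).card = 1 := by
    have := Finset.card_sdiff_add_card_eq_card hLO
    have := Finset.card_pos.2 ⟨s, hsO⟩
    omega
  obtain ⟨t, ht⟩ := Finset.card_eq_one.1 hOcard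
  have htO : t ∈ O ∧ t ∉ L := Finset.mem_sdiff.1 (ht ▸ Finset.mem_singleton_self t)
  have hAM : ∀ e ∈ A, (e.1, μ e.1) ∈ M := by
    intro e he
    apply hμ
    have : e.1 ∈ B.image Prod.fst := hfst ▸ Finset.mem_image_of_mem _ he
    exact Finset.image_subset_image hBM this
  have hBeq : B = A.image fun e => (e.1, μ e.1) := by
    ext f
    simp only [Finset.mem_image]
    constructor
    · intro hf
      obtain ⟨e, he, hef⟩ := Finset.mem_image.1 (Finset.mem_filter.1 hf).2
      exact ⟨e, he, hM _ (hAM e he) f (hBM hf) (Or.inl hef)⟩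
    · rintro ⟨e, he, rfl⟩
      exact Finset.mem_filter.2 ⟨hAM e he, Finset.mem_image.2 ⟨e, he, rfl⟩⟩
  have hsum : ∀ g : X × Y → ℤ, ∑ e ∈ B, g e = ∑ e ∈ A, g (e.1, μ e.1) := by
    intro g
    rw [hBeq, Finset.sum_image]
    intro e he f hf h
    exact hF e (hAF he) f (hAF hf) (Prod.ext_iff.1 h).1
  refine ⟨μ, A, t, hAF, hAM, ⟨_, Finset.mem_image_of_mem _ hsL, rfl⟩, ?_, ?_, ?_, ?_, ?_⟩
  · exact fun h => htO.2 (Finset.mem_filter.2 ⟨htO.1, h⟩)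
  · rintro rfl
    exact htO.2 hsL
  · intro y hy hys
    by_cases hyO : y ∈ O
    · right
      have : y ∈ B.image Prod.snd := hBsnd ▸ Finset.mem_erase.2 ⟨hys, hyO⟩
      rw [hBeq, Finset.image_image] at this
      obtain ⟨e, he, h⟩ := Finset.mem_image.1 this
      exact ⟨e, he, h⟩
    · left
      have hyF : y ∈ F.image Prod.snd := by
        rcases hy with hy | rfl
        · exact hy
        · exact absurd htO.1 hyO
      obtain ⟨e, he, rfl⟩ := Finset.mem_image.1 hyF
      refine ⟨e, he, fun heA => hyO ?_, rfl⟩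
      obtain ⟨z, hz, rfl⟩ := Finset.mem_image.1 heA
      exact hLO hz
  · rw [← hsum]
    linarith
  · intro f
    rw [← hsum fun e => f e.2]
    have e1 : ∑ e ∈ B, f e.2 = ∑ y ∈ O.erase s, f y := by
      rw [← hBsnd, Finset.sum_image]
      exact fun e he f hf h => hM e (hBM he) f (hBM hf) (Or.inr h)
    have e2 : ∑ e ∈ A, f e.2 = ∑ y ∈ L, f y :=
      Finset.sum_image fun y _ z _ h => congrArg Prod.snd h
    rw [e1, e2, Finset.sum_erase_add _ _ hsO, ← Finset.sum_sdiff hLO, ht, Finset.sum_singleton,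
      add_comm]

/-! ### Routes through a vertex cover -/

section Routes

variable {V : Type*} {G : SimpleGraph V} {C : Finset V} {ω : Sym2 V → ℕ}

/-- A step between the vertices `e.1.1` and `e.1.2` of the vertex cover `C`: it runs along an edge
of `G` if `e.2 = none`, and through the vertex `s ∉ C` if `e.2 = some s`. -/
def IsStep (G : SimpleGraph V) (C : Finset V) (e : (V × V) × Option V) : Prop :=
  e.1.1 ∈ C ∧ e.1.2 ∈ C ∧ (e.2 = none → G.Adj e.1.1 e.1.2) ∧
    ∀ s, e.2 = some s → s ∉ C ∧ G.Adj e.1.1 s ∧ G.Adj e.1.2 s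

/-- The weight of the edges of a step. -/
def stepWeight (ω : Sym2 V → ℕ) : (V × V) × Option V → ℕ
  | ((u, v), none) => ω s(u, v)
  | ((u, v), some s) => ω s(u, s) + ω s(s, v)

/-- `L` is a sequence of consecutive steps from `u` to `v`. -/
def IsRoute (G : SimpleGraph V) (C : Finset V) : V → V → List ((V × V) × Option V) → Prop
  | u, v, [] => u = v
  | u, v, e :: L => e.1.1 = u ∧ IsStep G C e ∧ IsRoute G C e.1.2 v L

/-- The vertex `s` outside the cover is visited by the route `L`. -/
def VisitsOutside (L : List ((V × V) × Option V)) (s : V) : Prop :=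
  some s ∈ L.map Prod.snd

/-- The route `L`, which starts at `c`, visits all vertices of `C`. -/
def CoversFrom (C : Finset V) (c : V) (L : List ((V × V) × Option V)) : Prop :=
  ∀ x ∈ C, x = c ∨ x ∈ L.map fun e => e.1.2

/-- The weight of the edges of a route. -/
def routeWeight (ω : Sym2 V → ℕ) (L : List ((V × V) × Option V)) : ℕ :=
  (L.map (stepWeight ω)).sum

open Classical in
/-- Half the weight of the cheapest loops to the vertices that the route `L` misses. -/
noncomputable def missedWeight [Fintype V] (G : SimpleGraph V) (C : Finset V) (ω : Sym2 V → ℕ)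
    (L : List ((V × V) × Option V)) : ℕ :=
  ∑ s with s ∉ C ∧ ¬ VisitsOutside L s, minWeight G ω s

/-- The weight of the route `L` together with a cheapest loop to each vertex that it misses. -/
noncomputable def routeCost [Fintype V] (G : SimpleGraph V) (C : Finset V) (ω : Sym2 V → ℕ)
    (L : List ((V × V) × Option V)) : ℕ :=
  routeWeight ω L + 2 * missedWeight G C ω L

open Classical in
/-- The contribution of a step to the measure that is decreased when a route is improved: it favors
few visits outside the cover `C`, and among these the visits in `S`. -/
noncomputable def stepRank (S : Finset V) (e : (V × V) × Option V) : ℕ :=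
  e.2.elim 0 fun s => if s ∈ S then 1 else 2

/-- The step `e`, traversed backwards. -/
def Step.reverse (e : (V × V) × Option V) : (V × V) × Option V :=
  (e.1.swap, e.2)

theorem minWeight_le {s w : V} (h : G.Adj s w) : minWeight G ω s ≤ ω s(s, w) :=
  Nat.sInf_le ⟨w, h, rfl⟩

theorem exists_minWeight {s w : V} (h : G.Adj s w) : ∃ x, G.Adj s x ∧ ω s(s, x) = minWeight G ω s :=
  let ⟨x, hx, hxs⟩ := Nat.sInf_mem (s := (fun w => ω s(s, w)) '' G.neighborSet s) ⟨_, w, h, rfl⟩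
  ⟨x, hx, hxs⟩

theorem isRoute_append {u w : V} {A B : List ((V × V) × Option V)} :
    IsRoute G C u w (A ++ B) ↔ ∃ v, IsRoute G C u v A ∧ IsRoute G C v w B := by
  induction A generalizing u with
  | nil => simp [IsRoute]
  | cons e A ih => simp [IsRoute, ih, and_assoc]

theorem IsRoute.isStep {u v : V} {L : List ((V × V) × Option V)} (h : IsRoute G C u v L) :
    ∀ e ∈ L, IsStep G C e := by
  induction L generalizing u with
  | nil => simp
  | cons e L ih =>
    intro f hf
    rcases List.mem_cons.1 hf with rfl | hf
    · exact h.2.1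
    · exact ih h.2.2 f hf

theorem IsRoute.end_mem {u v : V} {L : List ((V × V) × Option V)} (h : IsRoute G C u v L) :
    v = u ∨ v ∈ L.map fun e => e.1.2 := by
  induction L generalizing u with
  | nil => exact Or.inl (Eq.symm h)
  | cons e L ih =>
    rcases ih h.2.2 with h | h
    · exact Or.inr (by simp [h])
    · exact Or.inr (List.mem_cons_of_mem _ h)

/-- Up to the two ends of a route, its steps start where its steps end. -/
theorem IsRoute.mem_starts {u v x : V} {L : List ((V × V) × Option V)} (h : IsRoute G C u v L)
    (hx : x ∈ L.map fun e => e.1.2) : x = v ∨ x ∈ L.map fun e => e.1.1 := by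
  induction L generalizing u with
  | nil => simp at hx
  | cons e L ih =>
    rcases List.mem_cons.1 hx with rfl | hx
    · cases L with
      | nil => exact Or.inl h.2.2
      | cons f L => exact Or.inr (by simp [h.2.2.1])
    · exact (ih h.2.2 hx).imp_right (List.mem_cons_of_mem _)

theorem IsStep.reverse {e : (V × V) × Option V} (h : IsStep G C e) : IsStep G C (Step.reverse e) :=
  ⟨h.2.1, h.1, fun hn => (h.2.2.1 hn).symm, fun s hs =>
    let ⟨h1, h2, h3⟩ := h.2.2.2 s hs
    ⟨h1, h3, h2⟩⟩

theorem IsRoute.reverse {u v : V} {L : List ((V × V) × Option V)} (h : IsRoute G C u v L) :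
    IsRoute G C v u (L.map Step.reverse).reverse := by
  induction L generalizing u with
  | nil => exact Eq.symm h
  | cons e L ih =>
    rw [List.map_cons, List.reverse_cons, isRoute_append]
    exact ⟨_, ih h.2.2, rfl, h.2.1.reverse, h.1⟩

theorem stepWeight_reverse (e : (V × V) × Option V) :
    stepWeight ω (Step.reverse e) = stepWeight ω e := by
  obtain ⟨⟨u, v⟩, _ | s⟩ := e
  · simp [Step.reverse, stepWeight, Sym2.eq_swap]
  · simp [Step.reverse, stepWeight, Sym2.eq_swap, add_comm]

theorem IsRoute.map {u v : V} {L : List ((V × V) × Option V)}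
    {f : (V × V) × Option V → (V × V) × Option V} (hf : ∀ e, (f e).1 = e.1)
    (hs : ∀ e ∈ L, IsStep G C (f e)) (h : IsRoute G C u v L) : IsRoute G C u v (L.map f) := by
  induction L generalizing u with
  | nil => exact h
  | cons e L ih =>
    refine ⟨by rw [hf]; exact h.1, hs e (by simp), ?_⟩
    rw [hf]
    exact ih (fun e he => hs e (List.mem_cons_of_mem _ he)) h.2.2

theorem missedWeight_le_add [Fintype V] {L L' : List ((V × V) × Option V)} (s : V)
    (h : ∀ y, VisitsOutside L y → y ≠ s → VisitsOutside L' y) :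
    missedWeight G C ω L' ≤ missedWeight G C ω L + minWeight G ω s := by
  classical
  have : ∀ y ∈ (Finset.univ.filter fun y => y ∉ C ∧ ¬ VisitsOutside L' y),
      y ∈ (Finset.univ.filter fun y => y ∉ C ∧ ¬ VisitsOutside L y) ∪ {s} := by
    intro y hy
    simp only [Finset.mem_filter, Finset.mem_univ, true_and, Finset.mem_union,
      Finset.mem_singleton] at hy ⊢
    by_cases hys : y = s
    · exact Or.inr hys
    · exact Or.inl ⟨hy.1, fun hL => hy.2 (h y hL hys)⟩
  have h1 : missedWeight G C ω L' ≤ _ := Finset.sum_le_sum_of_subset (f := minWeight G ω) this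
  have h2 := Finset.sum_union_inter (f := minWeight G ω)
    (s₁ := Finset.univ.filter fun y => y ∉ C ∧ ¬ VisitsOutside L y) (s₂ := {s})
  rw [Finset.sum_singleton] at h2
  unfold missedWeight at h1 ⊢
  omega

/-- A loop `(u, s, u)` may be left out of a route. -/
theorem exists_route_of_loop [Fintype V] (S : Finset V) {c u s : V}
    {A B : List ((V × V) × Option V)}
    (h : IsRoute G C c c (A ++ ((u, u), some s) :: B))
    (hc : CoversFrom C c (A ++ ((u, u), some s) :: B)) :
    IsRoute G C c c (A ++ B) ∧ CoversFrom C c (A ++ B) ∧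
      routeCost G C ω (A ++ B) ≤ routeCost G C ω (A ++ ((u, u), some s) :: B) ∧
      ((A ++ B).map (stepRank S)).sum <
        ((A ++ ((u, u), some s) :: B).map (stepRank S)).sum := by
  obtain ⟨v, hA, rfl, he, hB⟩ := isRoute_append.1 h
  refine ⟨isRoute_append.2 ⟨_, hA, hB⟩, ?_, ?_, ?_⟩
  · intro x hx
    have h1 := hc x hx
    have h2 := hA.end_mem
    simp only [List.map_append, List.map_cons, List.mem_append, List.mem_cons] at h1 ⊢
    rcases h1 with h1 | h1 | rfl | h1
    · exact Or.inl h1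
    · exact Or.inr (Or.inl h1)
    · exact h2.imp_right Or.inl
    · exact Or.inr (Or.inr h1)
  · have h1 : missedWeight G C ω (A ++ B) ≤
        missedWeight G C ω (A ++ ((u, u), some s) :: B) + minWeight G ω s := by
      apply missedWeight_le_add
      intro y hy hys
      simpa [VisitsOutside, hys] using hy
    have h2 : minWeight G ω s ≤ ω s(s, u) := minWeight_le (he.2.2.2 s rfl).2.1.symm
    have h3 : ω s(u, s) = ω s(s, u) := by rw [Sym2.eq_swap]
    simp only [routeCost, routeWeight, List.map_append, List.map_cons, List.sum_append,
      List.sum_cons, stepWeight]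
    omega
  · simp only [List.map_append, List.map_cons, List.sum_append, List.sum_cons, stepRank,
      Option.elim_some]
    split_ifs <;> omega

/-- Two hops from `u` to `v` may be left out of a route if the part between them is reversed. -/
theorem exists_route_of_parallel [Fintype V] (S : Finset V) {c u v s t : V}
    {A B D : List ((V × V) × Option V)}
    (h : IsRoute G C c c (A ++ ((u, v), some s) :: (B ++ ((u, v), some t) :: D)))
    (hc : CoversFrom C c (A ++ ((u, v), some s) :: (B ++ ((u, v), some t) :: D))) :
    ∃ L, IsRoute G C c c L ∧ CoversFrom C c L ∧
      routeCost G C ω L ≤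
        routeCost G C ω (A ++ ((u, v), some s) :: (B ++ ((u, v), some t) :: D)) ∧
      (L.map (stepRank S)).sum <
        ((A ++ ((u, v), some s) :: (B ++ ((u, v), some t) :: D)).map (stepRank S)).sum := by
  obtain ⟨_, hA, rfl, he, h'⟩ := isRoute_append.1 h
  obtain ⟨_, hB, rfl, hf, hD⟩ := isRoute_append.1 h'
  refine ⟨A ++ ((B.map Step.reverse).reverse ++ D),
    isRoute_append.2 ⟨_, hA, isRoute_append.2 ⟨_, hB.reverse, hD⟩⟩, ?_, ?_, ?_⟩
  · -- Reversing `B` exchanges the start and the end of each of its steps, which matters for the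
    -- ends of `B` only; these are `u` and `v`, where `A` ends and the reversed `B` ends.
    have hrev : ∀ x, x ∈ (B.map Step.reverse).reverse.map (fun e => e.1.2) ↔
        x ∈ B.map fun e => e.1.1 := by
      intro x; simp [Step.reverse]
    have hu : u = c ∨ u ∈ A.map fun e => e.1.2 := hA.end_mem
    have hv : v = u ∨ v ∈ B.map fun e => e.1.1 :=
      hB.reverse.end_mem.imp_right (hrev v).1
    intro x hx
    have h1 := hc x hx
    have h2 : x ∈ B.map (fun e => e.1.2) → x = u ∨ x ∈ B.map fun e => e.1.1 := hB.mem_starts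
    have h3 := hrev x
    rw [List.map_append, List.map_append, List.mem_append, List.mem_append, h3]
    simp only [List.map_append, List.map_cons, List.mem_append, List.mem_cons] at h1
    by_cases hxu : x = u
    · subst hxu; tauto
    · by_cases hxv : x = v
      · subst hxv; tauto
      · tauto
  · have h0 : missedWeight G C ω (A ++ ((u, v), some s) :: (B ++ D)) ≤
        missedWeight G C ω (A ++ ((u, v), some s) :: (B ++ ((u, v), some t) :: D)) +
          minWeight G ω t := by
      apply missedWeight_le_add
      intro y hy hys
      simpa [VisitsOutside, hys] using hy
    have h1 : missedWeight G C ω (A ++ ((B.map Step.reverse).reverse ++ D)) ≤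
        missedWeight G C ω (A ++ ((u, v), some s) :: (B ++ D)) + minWeight G ω s := by
      apply missedWeight_le_add
      intro y hy hys
      simpa [VisitsOutside, hys, Step.reverse] using hy
    have es := he.2.2.2 s rfl
    have et := hf.2.2.2 t rfl
    have h2 : minWeight G ω s ≤ ω s(s, u) := minWeight_le es.2.1.symm
    have h3 : minWeight G ω s ≤ ω s(s, v) := minWeight_le es.2.2.symm
    have h4 : minWeight G ω t ≤ ω s(t, u) := minWeight_le et.2.1.symm
    have h5 : minWeight G ω t ≤ ω s(t, v) := minWeight_le et.2.2.symm
    have h6 : ω s(u, s) = ω s(s, u) := by rw [Sym2.eq_swap]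
    have h7 : ω s(u, t) = ω s(t, u) := by rw [Sym2.eq_swap]
    have h8 : (B.map (stepWeight ω ∘ Step.reverse)).sum = (B.map (stepWeight ω)).sum := by
      congr 1
      exact List.map_congr_left fun e _ => stepWeight_reverse e
    simp only [routeCost, routeWeight, List.map_append, List.map_cons, List.sum_append,
      List.sum_cons, stepWeight, List.map_reverse, List.sum_reverse, List.map_map, h8]
    omega
  · have h8 : stepRank S ∘ Step.reverse = stepRank S := rfl
    simp only [List.map_append, List.map_cons, List.sum_append, List.sum_cons,
      List.map_reverse, List.sum_reverse, List.map_map, h8]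
    have : ∀ x : V × V, ∀ y, 0 < stepRank S (x, some y) := by
      intro x y
      simp only [stepRank, Option.elim_some]
      split_ifs <;> omega
    have := this (u, v) s
    omega

open Classical in
/-- Reassign the hops in `A`: a hop over the pair `x` is made to visit `μ x`. -/
noncomputable def relabel (A : Finset ((V × V) × V)) (μ : V × V → V) (e : (V × V) × Option V) :
    (V × V) × Option V :=
  if ∃ h ∈ A, e = (h.1, some h.2) then (e.1, some (μ e.1)) else e

theorem relabel_of_mem {A : Finset ((V × V) × V)} {μ : V × V → V} {h : (V × V) × V}
    (hA : h ∈ A) : relabel A μ (h.1, some h.2) = (h.1, some (μ h.1)) :=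
  if_pos ⟨h, hA, rfl⟩

theorem relabel_of_notMem {A : Finset ((V × V) × V)} {μ : V × V → V} {e : (V × V) × Option V}
    (hA : ¬ ∃ h ∈ A, e = (h.1, some h.2)) : relabel A μ e = e :=
  if_neg hA

theorem relabel_fst (A : Finset ((V × V) × V)) (μ : V × V → V) (e : (V × V) × Option V) :
    (relabel A μ e).1 = e.1 := by
  unfold relabel; split_ifs <;> rfl

theorem count_append_cons_self {α : Type*} [DecidableEq α] {a : α} {l₁ l₂ : List α} (h₁ : a ∉ l₁)
    (h₂ : a ∉ l₂) : (l₁ ++ a :: l₂).count a = 1 := by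
  rw [List.count_append, List.count_cons_self, List.count_eq_zero_of_not_mem h₁,
    List.count_eq_zero_of_not_mem h₂]

/-- Relabelling changes a sum over the steps of a route by the contribution of the relabelled hops,
provided that these occur exactly once. -/
theorem sum_map_relabel [DecidableEq V] {A : Finset ((V × V) × V)} (μ : V × V → V)
    {L : List ((V × V) × Option V)} (f : (V × V) × Option V → ℤ)
    (hA : ∀ h ∈ A, ∃ L₁ L₂, L = L₁ ++ (h.1, some h.2) :: L₂ ∧
      (h.1, some h.2) ∉ L₁ ∧ (h.1, some h.2) ∉ L₂) :
    ((L.map (relabel A μ)).map f).sum + ∑ h ∈ A, f (h.1, some h.2) =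
      (L.map f).sum + ∑ h ∈ A, f (h.1, some (μ h.1)) := by
  have key : (L.map fun e => f (relabel A μ e) - f e).sum =
      ∑ h ∈ A, (f (h.1, some (μ h.1)) - f (h.1, some h.2)) := by
    rw [Finset.sum_list_map_count]
    have hinj : Set.InjOn (fun h : (V × V) × V => (h.1, some h.2)) A := by
      intro g _ h _ hgh
      obtain ⟨h1, h2⟩ := Prod.ext_iff.1 hgh
      exact Prod.ext h1 (Option.some_injective _ h2)
    rw [← Finset.sum_subset (s₁ := A.image fun h => (h.1, some h.2)), Finset.sum_image hinj]
    · refine Finset.sum_congr rfl fun h hh => ?_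
      obtain ⟨L₁, L₂, hL, h1, h2⟩ := hA h hh
      rw [hL, count_append_cons_self h1 h2, relabel_of_mem hh, one_smul]
    · intro e he
      obtain ⟨h, hh, rfl⟩ := Finset.mem_image.1 he
      obtain ⟨L₁, L₂, hL, -, -⟩ := hA h hh
      simp [hL]
    · intro e _ he
      rw [relabel_of_notMem, sub_self, smul_zero]
      rintro ⟨h, hh, rfl⟩
      exact he (Finset.mem_image.2 ⟨h, hh, rfl⟩)
  rw [Finset.sum_sub_distrib] at key
  have hsub : ∀ L' : List ((V × V) × Option V), (L'.map fun e => f (relabel A μ e) - f e).sum =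
      ((L'.map (relabel A μ)).map f).sum - (L'.map f).sum := by
    intro L'
    induction L' with
    | nil => simp
    | cons e L' ih =>
      simp only [List.map_cons, List.sum_cons, ih]
      ring
  have := hsub L
  linarith

end Routes

/-! ### Improving a route -/

section Improve

variable {V : Type*} {G : SimpleGraph V} {C : Finset V} {ω : Sym2 V → ℕ}

theorem stepWeight_eq_hopCost (G : SimpleGraph V) (ω : Sym2 V → ℕ) (h : (V × V) × V) :
    (stepWeight ω (h.1, some h.2) : ℤ) = hopCost G ω h + 2 * (minWeight G ω h.2 : ℤ) := by
  obtain ⟨⟨u, v⟩, s⟩ := h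
  simp [stepWeight, hopCost]

/-- Let a route contain neither loops nor two hops over the same ordered pair.  If it visits some
`s` that the matching `M` leaves free, then the exchange along the alternating path of `s` improves
it: fewer of its hops visit such vertices. -/
theorem exists_route_of_free [Fintype V] [DecidableEq V] {M : Finset ((V × V) × V)}
    (hM : IsMinCostMaxHopMatching G ω C M) {c s : V} {L : List ((V × V) × Option V)}
    (h : IsRoute G C c c L) (hc : CoversFrom C c L)
    (hloop : ∀ u y, ((u, u), some y) ∉ L)
    (hpar : ∀ A B D x y z, L ≠ A ++ (x, some y) :: (B ++ (x, some z) :: D))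
    (hs : VisitsOutside L s) (hsM : s ∉ M.image Prod.snd) :
    ∃ L', IsRoute G C c c L' ∧ CoversFrom C c L' ∧ routeCost G C ω L' ≤ routeCost G C ω L ∧
      (L'.map (stepRank (M.image Prod.snd))).sum < (L.map (stepRank (M.image Prod.snd))).sum := by
  classical
  let F : Finset ((V × V) × V) := Finset.univ.filter fun e => (e.1, some e.2) ∈ L
  have memF : ∀ e, e ∈ F ↔ (e.1, some e.2) ∈ L := fun e => by simp [F]
  have hFL : ∀ y, y ∈ F.image Prod.snd ↔ VisitsOutside L y := by
    intro y
    simp only [Finset.mem_image, memF, VisitsOutside, List.mem_map]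
    constructor
    · rintro ⟨e, he, rfl⟩
      exact ⟨_, he, rfl⟩
    · rintro ⟨e, he, hy⟩
      exact ⟨(e.1, y), by rwa [← hy], rfl⟩
  have hFE : ∀ e ∈ F, e ∈ hopEdges G C := by
    intro e he
    rw [memF] at he
    have h1 := h.isStep _ he
    have h2 := h1.2.2.2 _ rfl
    refine ⟨h1.1, h1.2.1, ?_, h2.1, h2.2.1, h2.2.2⟩
    intro heq
    apply hloop e.1.1 e.2
    rwa [show (e.1.1, e.1.1) = e.1 from Prod.ext rfl heq]
  have hF : ∀ e ∈ F, ∀ f ∈ F, e.1 = f.1 → e = f := by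
    rintro ⟨x, y⟩ he ⟨x', z⟩ hf (rfl : x = x')
    rw [memF] at he hf
    by_contra hne
    obtain ⟨A, B, rfl⟩ := List.append_of_mem he
    rcases List.mem_append.1 hf with hf | hf
    · obtain ⟨A₁, A₂, rfl⟩ := List.append_of_mem hf
      exact hpar A₁ A₂ B x z y (by simp)
    · rcases List.mem_cons.1 hf with hf | hf
      · exact hne (Prod.ext rfl (Option.some_injective _ (Prod.ext_iff.1 hf).2).symm)
      · obtain ⟨B₁, B₂, rfl⟩ := List.append_of_mem hf
        exact hpar A B₁ B₂ x y z rfl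
  obtain ⟨μ, A, t, hAF, hAM, ⟨e₀, he₀, he₀s⟩, htF, hts, hcov, hcost, hsum⟩ :=
    exists_matching_exchange (hopEdges G C) (hopCost G ω) M F hM.1.1 hM.1.2
      (fun M' h1 h2 => hM.2.1 M' ⟨h1, h2⟩) (fun M' h1 h2 => hM.2.2 M' ⟨h1, h2⟩) hFE hF s
      ((hFL s).2 hs) hsM
  have htC : t ∉ C := by
    rcases hcov t (Or.inr rfl) hts with ⟨e, he, -, rfl⟩ | ⟨e, he, rfl⟩
    · exact absurd (Finset.mem_image_of_mem _ he) htF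
    · exact (hM.1.1 _ (hAM e he)).2.2.2.1
  have hvis : ∀ y, VisitsOutside L y ∨ y = t → y ≠ s →
      VisitsOutside (L.map (relabel A μ)) y := by
    intro y hy hys
    simp only [VisitsOutside, List.mem_map]
    rcases hcov y (hy.imp_left (hFL y).2) hys with ⟨e, he, heA, rfl⟩ | ⟨e, he, rfl⟩
    · refine ⟨_, ⟨_, (memF e).1 he, relabel_of_notMem ?_⟩, rfl⟩
      rintro ⟨f, hf, hef⟩
      obtain rfl : e = f :=
        Prod.ext (Prod.ext_iff.1 hef).1 (Option.some_injective _ (Prod.ext_iff.1 hef).2)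
      exact heA hf
    · exact ⟨_, ⟨_, (memF e).1 (hAF he), relabel_of_mem he⟩, rfl⟩
  have honce : ∀ e ∈ A, ∃ L₁ L₂, L = L₁ ++ (e.1, some e.2) :: L₂ ∧
      (e.1, some e.2) ∉ L₁ ∧ (e.1, some e.2) ∉ L₂ := by
    intro e he
    obtain ⟨L₁, L₂, hL⟩ := List.append_of_mem ((memF e).1 (hAF he))
    refine ⟨L₁, L₂, hL, fun h1 => ?_, fun h2 => ?_⟩
    · obtain ⟨A₁, A₂, rfl⟩ := List.append_of_mem h1
      exact hpar A₁ A₂ L₂ e.1 e.2 e.2 (by rw [hL]; simp)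
    · obtain ⟨A₁, A₂, rfl⟩ := List.append_of_mem h2
      exact hpar L₁ A₁ A₂ _ _ _ hL
  refine ⟨L.map (relabel A μ), h.map (relabel_fst A μ) ?_, ?_, ?_, ?_⟩
  · intro e he
    by_cases heA : ∃ f ∈ A, e = (f.1, some f.2)
    · obtain ⟨f, hf, rfl⟩ := heA
      rw [relabel_of_mem hf]
      obtain ⟨h1, h2, -, h3, h4, h5⟩ := hM.1.1 _ (hAM f hf)
      exact ⟨h1, h2, nofun, fun y hy => Option.some_injective _ hy ▸ ⟨h3, h4, h5⟩⟩
    · rw [relabel_of_notMem heA]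
      exact h.isStep e he
  · intro x hx
    rw [List.map_map, show (fun e : (V × V) × Option V => e.1.2) ∘ relabel A μ = fun e => e.1.2 from
      funext fun e => by simp [relabel_fst]]
    exact hc x hx
  · have h1 := sum_map_relabel μ (fun e => (stepWeight ω e : ℤ)) honce
    simp only [stepWeight_eq_hopCost G, stepWeight_eq_hopCost G ω (_, μ _),
      Finset.sum_add_distrib, ← Finset.mul_sum] at h1
    have h2 := hsum fun y => (minWeight G ω y : ℤ)
    have h3 : missedWeight G C ω (L.map (relabel A μ)) + minWeight G ω t ≤
        missedWeight G C ω L + minWeight G ω s := by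
      unfold missedWeight
      rw [add_comm, add_comm _ (minWeight G ω s), ← Finset.sum_insert, ← Finset.sum_insert]
      · apply Finset.sum_le_sum_of_subset
        intro y hy
        simp only [Finset.mem_insert, Finset.mem_filter, Finset.mem_univ, true_and] at hy ⊢
        by_cases hys : y = s
        · exact Or.inl hys
        · right
          rcases hy with rfl | hy
          · exact ⟨htC, fun hL => htF ((hFL y).2 hL)⟩
          · exact ⟨hy.1, fun hL => hy.2 (hvis y (Or.inl hL) hys)⟩
      · simp [hs]
      · simp [hvis t (Or.inr rfl) hts]
    have h4 : ∀ L : List ((V × V) × Option V),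
        (L.map fun e => (stepWeight ω e : ℤ)).sum = (routeWeight ω L : ℤ) := by
      intro L
      rw [routeWeight, Nat.cast_list_sum, List.map_map]
      rfl
    rw [h4, h4] at h1
    unfold routeCost
    zify at h3 ⊢
    linarith
  · rw [List.map_map]
    refine List.sum_lt_sum _ _ (fun e he => ?_) ⟨_, (memF e₀).1 (hAF he₀), ?_⟩
    · by_cases heA : ∃ f ∈ A, e = (f.1, some f.2)
      · obtain ⟨f, hf, rfl⟩ := heA
        have := Finset.mem_image_of_mem Prod.snd (hAM f hf)
        simp only [Function.comp, relabel_of_mem hf, stepRank, Option.elim_some, if_pos this]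
        split_ifs <;> omega
      · simp [relabel_of_notMem heA]
    · have := Finset.mem_image_of_mem Prod.snd (hAM e₀ he₀)
      rw [he₀s]
      have h5 : relabel A μ (e₀.1, some s) = (e₀.1, some (μ e₀.1)) := by
        rw [← he₀s]; exact relabel_of_mem he₀
      simp only [Function.comp, h5, stepRank, Option.elim_some, if_pos this, if_neg hsM]
      omega

/-- Every route can be turned, without an increase in cost, into one that leaves the cover `C` only
for vertices matched by `M`. -/
theorem exists_route_matched [Fintype V] [DecidableEq V] {M : Finset ((V × V) × V)}
    (hM : IsMinCostMaxHopMatching G ω C M) {c : V} (L : List ((V × V) × Option V))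
    (h : IsRoute G C c c L) (hc : CoversFrom C c L) :
    ∃ L', IsRoute G C c c L' ∧ CoversFrom C c L' ∧ routeCost G C ω L' ≤ routeCost G C ω L ∧
      ∀ s, VisitsOutside L' s → s ∈ M.image Prod.snd := by
  induction hr : (L.map (stepRank (M.image Prod.snd))).sum using Nat.strong_induction_on
    generalizing L with
  | _ r ih =>
    have step : (∃ L', IsRoute G C c c L' ∧ CoversFrom C c L' ∧
        routeCost G C ω L' ≤ routeCost G C ω L ∧
        (L'.map (stepRank (M.image Prod.snd))).sum < (L.map (stepRank (M.image Prod.snd))).sum) →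
        ∃ L', IsRoute G C c c L' ∧ CoversFrom C c L' ∧ routeCost G C ω L' ≤ routeCost G C ω L ∧
          ∀ s, VisitsOutside L' s → s ∈ M.image Prod.snd := by
      rintro ⟨L', h1, h2, h3, h4⟩
      obtain ⟨L'', h5, h6, h7, h8⟩ := ih _ (hr ▸ h4) L' h1 h2 rfl
      exact ⟨L'', h5, h6, h7.trans h3, h8⟩
    by_cases hloop : ∃ u y, ((u, u), some y) ∈ L
    · obtain ⟨u, y, hy⟩ := hloop
      obtain ⟨A, B, rfl⟩ := List.append_of_mem hy
      exact step ⟨_, exists_route_of_loop _ h hc⟩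
    by_cases hpar : ∃ A B D x y z, L = A ++ (x, some y) :: (B ++ (x, some z) :: D)
    · obtain ⟨A, B, D, ⟨u, v⟩, y, z, rfl⟩ := hpar
      exact step (exists_route_of_parallel _ h hc)
    by_cases hfree : ∃ s, VisitsOutside L s ∧ s ∉ M.image Prod.snd
    · obtain ⟨s, hs, hsM⟩ := hfree
      push Not at hloop hpar
      exact step (exists_route_of_free hM h hc hloop hpar hs hsM)
    · push Not at hfree
      exact ⟨L, h, hc, le_rfl, hfree⟩

end Improve

/-! ### Routes and walks -/

section Conversion

variable {V : Type*} {G : SimpleGraph V} {C : Finset V} {ω : Sym2 V → ℕ}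

theorem walkWeight_cons {u v w : V} (h : G.Adj u v) (p : G.Walk v w) :
    walkWeight ω (.cons h p) = ω s(u, v) + walkWeight ω p := by
  simp [walkWeight]

/-- A walk between vertices of the cover decomposes into steps, as the other vertices are
independent.  For the induction, the second part treats a walk that starts with the second half of
a step. -/
theorem exists_route_of_walk (hC : G.IsVertexCover (C : Set V)) (ω : Sym2 V → ℕ) {u v : V}
    (p : G.Walk u v) (hv : v ∈ C) :
    (u ∈ C → ∃ L, IsRoute G C u v L ∧ routeWeight ω L = walkWeight ω p ∧
      (∀ x ∈ p.support, x ∈ C → x = u ∨ x ∈ L.map fun e => e.1.2) ∧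
      ∀ x ∈ p.support, x ∉ C → VisitsOutside L x) ∧
    (u ∉ C → ∀ a ∈ C, G.Adj a u → ∃ L, IsRoute G C a v L ∧
      routeWeight ω L = ω s(a, u) + walkWeight ω p ∧
      (∀ x ∈ p.support, x ∈ C → x ∈ L.map fun e => e.1.2) ∧
      ∀ x ∈ p.support, x ∉ C → VisitsOutside L x) := by
  induction p with
  | nil =>
    refine ⟨fun _ => ⟨[], rfl, rfl, ?_, ?_⟩, fun h => absurd hv h⟩
    · intro x hx _
      exact Or.inl (by simpa using hx)
    · intro x hx hxC
      rw [SimpleGraph.Walk.support_nil, List.mem_singleton] at hx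
      exact absurd (hx ▸ hv) hxC
  | @cons u w v h p ih =>
    obtain ⟨ih1, ih2⟩ := ih hv
    constructor
    · intro hu
      by_cases hw : w ∈ C
      · obtain ⟨L, h1, h2, h3, h4⟩ := ih1 hw
        refine ⟨((u, w), none) :: L, ⟨rfl, ⟨hu, hw, fun _ => h, nofun⟩, h1⟩, ?_, ?_, ?_⟩
        · rw [walkWeight_cons, ← h2]; rfl
        · intro x hx hxC
          rw [SimpleGraph.Walk.support_cons, List.mem_cons] at hx
          rcases hx with rfl | hx
          · exact Or.inl rfl
          · exact Or.inr (List.mem_cons.2 (h3 x hx hxC))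
        · intro x hx hxC
          rw [SimpleGraph.Walk.support_cons, List.mem_cons] at hx
          rcases hx with rfl | hx
          · exact absurd hu hxC
          · exact List.mem_cons_of_mem _ (h4 x hx hxC)
      · obtain ⟨L, h1, h2, h3, h4⟩ := ih2 hw u hu h
        refine ⟨L, h1, by rw [h2, walkWeight_cons], ?_, ?_⟩
        · intro x hx hxC
          rw [SimpleGraph.Walk.support_cons, List.mem_cons] at hx
          exact hx.imp_right fun hx => h3 x hx hxC
        · intro x hx hxC
          rw [SimpleGraph.Walk.support_cons, List.mem_cons] at hx
          rcases hx with rfl | hx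
          · exact absurd hu hxC
          · exact h4 x hx hxC
    · intro hu a ha hau
      have hw : w ∈ C := (hC h).resolve_left hu
      obtain ⟨L, h1, h2, h3, h4⟩ := ih1 hw
      refine ⟨((a, w), some u) :: L, ⟨rfl, ⟨ha, hw, nofun, fun y hy => ?_⟩, h1⟩, ?_, ?_, ?_⟩
      · obtain rfl := Option.some_injective _ hy
        exact ⟨hu, hau, h.symm⟩
      · rw [walkWeight_cons, ← h2, ← add_assoc]; rfl
      · intro x hx hxC
        rw [SimpleGraph.Walk.support_cons, List.mem_cons] at hx
        rcases hx with rfl | hx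
        · exact absurd hxC hu
        · exact List.mem_cons.2 (h3 x hx hxC)
      · intro x hx hxC
        rw [SimpleGraph.Walk.support_cons, List.mem_cons] at hx
        rcases hx with rfl | hx
        · exact List.mem_cons_self
        · exact List.mem_cons_of_mem _ (h4 x hx hxC)

theorem IsRoute.exists_walk {u v : V} {L : List ((V × V) × Option V)} (h : IsRoute G C u v L)
    (ω : Sym2 V → ℕ) :
    ∃ p : G.Walk u v, walkWeight ω p = routeWeight ω L ∧
      ∀ x, x ∈ p.support ↔ x = u ∨ x ∈ L.map (fun e => e.1.2) ∨ VisitsOutside L x := by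
  induction L generalizing u with
  | nil =>
    obtain rfl : u = v := h
    exact ⟨.nil, rfl, by simp [VisitsOutside]⟩
  | cons e L ih =>
    obtain ⟨rfl, he, hL⟩ := h
    obtain ⟨p, hp, hps⟩ := ih hL
    obtain ⟨⟨a, b⟩, _ | s⟩ := e
    · refine ⟨.cons (he.2.2.1 rfl) p, ?_, fun x => ?_⟩
      · rw [walkWeight_cons, hp]; rfl
      · simp [hps, VisitsOutside, or_assoc]
    · obtain ⟨-, h1, h2⟩ := he.2.2.2 s rfl
      refine ⟨.cons h1 (.cons h2.symm p), ?_, fun x => ?_⟩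
      · rw [walkWeight_cons, walkWeight_cons, hp, ← add_assoc]; rfl
      · simp only [SimpleGraph.Walk.support_cons, List.mem_cons, hps, VisitsOutside, List.map_cons,
          Option.some_inj]
        tauto

end Conversion

/-! ### Adding loops -/

section Loops

variable {V : Type*} {G : SimpleGraph V} {ω : Sym2 V → ℕ}

theorem exists_walk_insert_loop {u v s w : V} (h : G.Adj s w) (p : G.Walk u v) {p₁ p₂ : List V}
    (hp : p.support = p₁ ++ w :: p₂) :
    ∃ q : G.Walk u v, q.support = p₁ ++ w :: s :: w :: p₂ ∧
      walkWeight ω q = walkWeight ω p + 2 * ω s(s, w) := by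
  induction p generalizing p₁ with
  | @nil u =>
    cases p₁ with
    | nil =>
      rw [SimpleGraph.Walk.support_nil, List.nil_append, List.cons_eq_cons] at hp
      obtain ⟨rfl, rfl⟩ := hp
      refine ⟨.cons h.symm (.cons h .nil), rfl, ?_⟩
      rw [walkWeight_cons, walkWeight_cons, Sym2.eq_swap (a := u)]
      ring
    | cons a p₁ =>
      rw [SimpleGraph.Walk.support_nil, List.cons_append, List.cons_eq_cons] at hp
      exact absurd hp.2.symm (by simp)
  | @cons u x v hx p ih =>
    rw [SimpleGraph.Walk.support_cons] at hp
    cases p₁ with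
    | nil =>
      rw [List.nil_append, List.cons_eq_cons] at hp
      obtain ⟨rfl, rfl⟩ := hp
      refine ⟨.cons h.symm (.cons h (.cons hx p)), rfl, ?_⟩
      rw [walkWeight_cons, walkWeight_cons, Sym2.eq_swap (a := u)]
      ring
    | cons a p₁ =>
      rw [List.cons_append, List.cons_eq_cons] at hp
      obtain ⟨rfl, hp⟩ := hp
      obtain ⟨q, hq, hqw⟩ := ih hp
      refine ⟨.cons hx q, by rw [SimpleGraph.Walk.support_cons, hq]; rfl, ?_⟩
      rw [walkWeight_cons, walkWeight_cons, hqw]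
      ring

theorem AddsCheapestLoops.exists_walk {l D m : List V} (h : AddsCheapestLoops G ω l D m)
    {u v : V} (p : G.Walk u v) (hp : p.support = l) :
    ∃ q : G.Walk u v, q.support = m ∧
      walkWeight ω q = walkWeight ω p + 2 * (D.map (minWeight G ω)).sum := by
  induction h generalizing p with
  | nil l => exact ⟨p, hp, by simp⟩
  | cons p₁ p₂ w s D m hadj hmin _ ih =>
    obtain ⟨q, hq, hqw⟩ := exists_walk_insert_loop (ω := ω) hadj p hp
    obtain ⟨r, hr, hrw⟩ := ih q hq
    refine ⟨r, hr, ?_⟩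
    rw [hrw, hqw, hmin, List.map_cons, List.sum_cons]
    ring

theorem AddsCheapestLoops.mem_iff {l D m : List V} (h : AddsCheapestLoops G ω l D m) (x : V) :
    x ∈ m ↔ x ∈ l ∨ x ∈ D := by
  induction h with
  | nil l => simp
  | cons p₁ p₂ w s D m _ _ _ ih =>
    rw [ih]
    simp only [List.mem_append, List.mem_cons]
    tauto

theorem AddsCheapestLoops.append_right {l D m : List V} (h : AddsCheapestLoops G ω l D m)
    (r : List V) : AddsCheapestLoops G ω (l ++ r) D (m ++ r) := by
  induction h with
  | nil l => exact .nil _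
  | cons p₁ p₂ w s D m hadj hmin _ ih =>
    rw [List.append_assoc, List.cons_append] at ih ⊢
    exact .cons _ _ _ _ _ _ hadj hmin ih

theorem AddsCheapestLoops.trans {l D m D' r : List V} (h : AddsCheapestLoops G ω l D m)
    (h' : AddsCheapestLoops G ω m D' r) : AddsCheapestLoops G ω l (D ++ D') r := by
  induction h with
  | nil l => exact h'
  | cons p₁ p₂ w s D m hadj hmin _ ih => exact .cons _ _ _ _ _ _ hadj hmin (ih h')

theorem exists_addsCheapestLoops (D : List V) (l : List V)
    (h : ∀ s ∈ D, ∃ w ∈ l, G.Adj s w ∧ ω s(s, w) = minWeight G ω s) :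
    ∃ m, AddsCheapestLoops G ω l D m := by
  induction D generalizing l with
  | nil => exact ⟨l, .nil l⟩
  | cons s D ih =>
    obtain ⟨w, hw, hadj, hmin⟩ := h s (by simp)
    obtain ⟨p₁, p₂, rfl⟩ := List.append_of_mem hw
    obtain ⟨m, hm⟩ := ih (p₁ ++ w :: s :: w :: p₂) fun t ht => by
      obtain ⟨x, hx, h1⟩ := h t (List.mem_cons_of_mem _ ht)
      refine ⟨x, ?_, h1⟩
      simp only [List.mem_append, List.mem_cons] at hx ⊢
      tauto
    exact ⟨m, .cons _ _ _ _ _ _ hadj hmin hm⟩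

theorem infix_append_cons {a x b w : V} (hx : x ≠ w) {p₁ p₂ : List V}
    (h : [a, x, b] <:+: p₁ ++ w :: p₂) : [a, x, b] <:+: p₁ ++ [w] ∨ [a, x, b] <:+: w :: p₂ := by
  induction p₁ with
  | nil => exact Or.inr h
  | cons y p₁ ih =>
    rcases List.infix_cons_iff.1 h with h | h
    · left
      rcases p₁ with _ | ⟨z, _ | ⟨z', p₁⟩⟩
      · simp [List.cons_prefix_cons] at h
        exact absurd h.2.1 hx
      · simp [List.cons_prefix_cons] at h
        obtain ⟨rfl, rfl, rfl⟩ := h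
        exact List.infix_rfl
      · simp [List.cons_prefix_cons] at h
        obtain ⟨rfl, rfl, rfl⟩ := h
        exact ⟨[], p₁ ++ [w], rfl⟩
    · exact (ih h).imp_left fun h => List.infix_cons_iff.2 (Or.inr h)

/-- If a vertex sequence traverses the vertices outside `K` by loops only, then this remains true
after loops to vertices outside `K` have been added at vertices of `K`. -/
theorem AddsCheapestLoops.loops_only {l D m : List V} (h : AddsCheapestLoops G ω l D m)
    {K : Set V} (hK : ∀ s ∈ D, ∀ w, G.Adj s w → w ∈ K)
    (hl : ∀ a x b, x ∉ K → [a, x, b] <:+: l → a = b) :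
    ∀ a x b, x ∉ K → [a, x, b] <:+: m → a = b := by
  induction h with
  | nil l => exact hl
  | cons p₁ p₂ w s D m hadj _ _ ih =>
    refine ih (fun s hs => hK s (List.mem_cons_of_mem _ hs)) fun a x b hx hi => ?_
    have hw : w ∈ K := hK s (by simp) w hadj
    have hxw : x ≠ w := fun h => hx (h ▸ hw)
    rcases infix_append_cons hxw hi with hi | hi
    · refine hl a x b hx (hi.trans ⟨[], p₂, by simp⟩)
    · rcases infix_append_cons (p₁ := [w, s]) hxw hi with hi | hi
      · have := hi.eq_of_length (by simp)
        simp at this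
        exact this.1.trans this.2.2.symm
      · exact hl a x b hx (hi.trans ⟨p₁, [], by simp⟩)

/-- A closed walk based at a vertex of `K` that traverses `s ∉ K` by loops when read linearly does
so when read cyclically. -/
theorem traversesByLoops_of_support {K : Set V} {c s : V} (p : G.Walk c c) (hc : c ∈ K)
    (hs : s ∉ K) (hsp : s ∈ p.support) (h : ∀ a b, [a, s, b] <:+: p.support → a = b) :
    TraversesByLoops p s := by
  have hsc : s ≠ c := fun h => hs (h ▸ hc)
  have happ : (p.append p).support = p.support ++ p.support.tail :=
    SimpleGraph.Walk.support_append p p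
  constructor
  · obtain ⟨l₁, l₂, hl⟩ := List.append_of_mem hsp
    rcases List.eq_nil_or_concat l₁ with rfl | ⟨l₁, a, rfl⟩
    · exact absurd (List.cons_eq_cons.1 (p.cons_tail_support.trans hl)).1.symm hsc
    rcases l₂ with _ | ⟨b, l₂⟩
    · have := p.getLast_support
      simp only [hl, List.getLast_append_singleton] at this
      exact absurd this hsc
    have hi : [a, s, b] <:+: p.support := ⟨l₁, l₂, by rw [hl]; simp⟩
    obtain rfl := h a b hi
    exact ⟨a, hi.trans (happ ▸ ⟨[], p.support.tail, by simp⟩)⟩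
  · intro a b hab
    have hlast : p.support = p.support.dropLast ++ [c] := by
      conv_lhs => rw [← List.dropLast_append_getLast p.support_ne_nil, p.getLast_support]
    rw [Traverses, happ, hlast, List.append_assoc, ← hlast] at hab
    rcases infix_append_cons hsc hab with hi | hi
    · exact h a b (hlast ▸ hi)
    · exact h a b (p.cons_tail_support ▸ hi)

end Loops

/-! ### The reduced instance -/

section Kernel

variable {V : Type*} {G : SimpleGraph V} {C : Finset V} {ω : Sym2 V → ℕ}

theorem walkWeight_rotate [DecidableEq V] {v c : V} (Q : G.Walk v v) (h : c ∈ Q.support) :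
    walkWeight ω (Q.rotate c h) = walkWeight ω Q :=
  ((Q.rotate_edges c h).perm.map ω).sum_eq

/-- A tour of `G` can be replaced by a closed walk on the kept vertices such that this walk,
together with a cheapest loop to each deleted vertex, is no heavier. -/
theorem exists_walk_on_kept [Fintype V] [DecidableEq V] {M : Finset ((V × V) × V)}
    (hC : G.IsVertexCover (C : Set V)) (hM : IsMinCostMaxHopMatching G ω C M)
    (hN : ∀ s, ∃ w, G.Adj s w) {c : V} (hc : c ∈ C) {v : V} (Q : G.Walk v v) (hQ : IsTour Q) :
    ∃ p : G.Walk c c, (∀ x, x ∈ p.support ↔ x ∈ kept C M) ∧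
      walkWeight ω p + 2 * ∑ s ∈ (kept C M)ᶜ, minWeight G ω s ≤ walkWeight ω Q := by
  classical
  have hQc : ∀ x, x ∈ (Q.rotate c (hQ c)).support := fun x =>
    (Q.mem_support_rotate_iff c (hQ c)).2 (hQ x)
  obtain ⟨L, h1, h2, h3, h4⟩ := (exists_route_of_walk hC ω (Q.rotate c (hQ c)) hc).1 hc
  obtain ⟨L', h5, h6, h7, h8⟩ := exists_route_matched hM L h1 fun x hx => h3 x (hQc x) hx
  obtain ⟨p, hp, hps⟩ := h5.exists_walk ω
  -- The kept vertices that the improved route misses; a cheapest loop is added for each of them.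
  let D : Finset V := (M.image Prod.snd).filter fun s => ¬ VisitsOutside L' s
  have hMC : ∀ s ∈ M.image Prod.snd, s ∉ C := by
    intro s hs
    obtain ⟨e, he, rfl⟩ := Finset.mem_image.1 hs
    exact (hM.1.1 e he).2.2.2.1
  have hCp : ∀ x ∈ C, x ∈ p.support := fun x hx => (hps x).2 ((h6 x hx).imp_right Or.inl)
  obtain ⟨m, hm⟩ := exists_addsCheapestLoops (G := G) (ω := ω) D.toList p.support fun s hs => by
    rw [Finset.mem_toList, Finset.mem_filter] at hs
    obtain ⟨w, hw⟩ := hN s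
    obtain ⟨x, hx, hxs⟩ := exists_minWeight (ω := ω) hw
    exact ⟨x, hCp x ((hC hx).resolve_left (hMC s hs.1)), hx, hxs⟩
  obtain ⟨q, hq, hqw⟩ := hm.exists_walk p rfl
  refine ⟨q, fun x => ?_, ?_⟩
  · rw [hq, hm.mem_iff, hps, Finset.mem_toList, Finset.mem_filter, kept, Finset.mem_union]
    constructor
    · rintro ((rfl | hx | hx) | hx)
      · exact Or.inl hc
      · obtain ⟨e, he, rfl⟩ := List.mem_map.1 hx
        exact Or.inl (h5.isStep e he).2.1
      · exact Or.inr (h8 x hx)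
      · exact Or.inr hx.1
    · rintro (hx | hx)
      · exact Or.inl ((hps x).1 (hCp x hx))
      · by_cases hv : VisitsOutside L' x
        · exact Or.inl (Or.inr (Or.inr hv))
        · exact Or.inr ⟨hx, hv⟩
  · have e1 : missedWeight G C ω L = 0 := by
      refine Finset.sum_eq_zero fun s hs => ?_
      obtain ⟨hsC, hsL⟩ : s ∉ C ∧ ¬ VisitsOutside L s := by simpa using hs
      exact absurd (h4 s (hQc s) hsC) hsL
    have e2 : missedWeight G C ω L' = ∑ s ∈ D, minWeight G ω s +
        ∑ s ∈ (kept C M)ᶜ, minWeight G ω s := by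
      rw [← Finset.sum_union, missedWeight]
      · congr 1
        ext s
        simp only [Finset.mem_filter, Finset.mem_univ, true_and, Finset.mem_union, D,
          Finset.mem_compl, kept]
        have := hMC s
        have := h8 s
        tauto
      · rw [Finset.disjoint_left]
        intro s hs hs'
        rw [Finset.mem_compl, kept, Finset.mem_union] at hs'
        exact hs' (Or.inr (Finset.mem_filter.1 hs).1)
    have e3 : (D.toList.map (minWeight G ω)).sum = ∑ s ∈ D, minWeight G ω s :=
      Finset.sum_map_toList ..
    rw [hqw, hp]
    rw [routeCost, routeCost, e1, e2, h2, walkWeight_rotate] at h7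
    omega

theorem exists_adj_of_connected [Nontrivial V] (hG : G.Connected) (s : V) : ∃ w, G.Adj s w :=
  hG.preconnected.exists_adj_of_nontrivial s

theorem exists_tour [Fintype V] (hG : G.Connected) : ∃ (v : V) (Q : G.Walk v v), IsTour Q := by
  classical
  obtain ⟨v⟩ := hG.nonempty
  have key : ∀ T : Finset V, ∃ Q : G.Walk v v, ∀ x ∈ T, x ∈ Q.support := by
    intro T
    induction T using Finset.induction_on with
    | empty => exact ⟨.nil, by simp⟩
    | insert y T _ ih =>
      obtain ⟨Q, hQ⟩ := ih
      obtain ⟨p⟩ := hG.preconnected v y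
      refine ⟨Q.append (p.append p.reverse), fun x hx => ?_⟩
      rcases Finset.mem_insert.1 hx with rfl | hx
      · simp
      · simp [hQ x hx]
  obtain ⟨Q, hQ⟩ := key Finset.univ
  exact ⟨v, Q, fun x => hQ x (Finset.mem_univ x)⟩

theorem exists_optimalTour [Fintype V] (hG : G.Connected) (ω : Sym2 V → ℕ) :
    ∃ (v : V) (Q : G.Walk v v), IsOptimalTour ω Q := by
  classical
  have hex : ∃ k, ∃ (v : V) (Q : G.Walk v v), IsTour Q ∧ walkWeight ω Q = k :=
    let ⟨v, Q, hQ⟩ := exists_tour hG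
    ⟨_, v, Q, hQ, rfl⟩
  obtain ⟨v, Q, hQ, hQw⟩ := Nat.find_spec hex
  exact ⟨v, Q, hQ, fun u q hq => hQw ▸ Nat.find_min' hex ⟨u, q, hq, rfl⟩⟩

theorem cover_subset_kept [DecidableEq V] (C : Finset V) (M : Finset ((V × V) × V)) :
    C ⊆ kept C M :=
  Finset.subset_union_left

/-- The neighbors of a deleted vertex are kept. -/
theorem mem_kept_of_adj [DecidableEq V] {M : Finset ((V × V) × V)}
    (hC : G.IsVertexCover (C : Set V)) {s w : V} (hs : s ∉ kept C M) (h : G.Adj s w) :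
    w ∈ kept C M :=
  cover_subset_kept C M ((hC h).resolve_left fun h => hs (cover_subset_kept C M h))

theorem exists_optimalTour_loops [Fintype V] [DecidableEq V] [Nontrivial V]
    {M : Finset ((V × V) × V)} (hG : G.Connected) (hC : G.IsVertexCover (C : Set V))
    (hM : IsMinCostMaxHopMatching G ω C M) :
    ∃ (v : V) (P : G.Walk v v), IsOptimalTour ω P ∧ ∀ s ∉ kept C M, TraversesByLoops P s := by
  have hN := exists_adj_of_connected hG
  obtain ⟨v, Q, hQ⟩ := exists_optimalTour hG ω
  obtain ⟨w, hw⟩ := hN v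
  obtain ⟨c, hc⟩ : ∃ c, c ∈ C := (hC hw).elim (fun h => ⟨_, h⟩) fun h => ⟨_, h⟩
  obtain ⟨p, hp, hpw⟩ := exists_walk_on_kept hC hM hN hc Q hQ.1
  have hD : ∀ s, s ∈ ((kept C M)ᶜ).toList ↔ s ∉ kept C M := fun s => by simp
  obtain ⟨m, hm⟩ := exists_addsCheapestLoops (G := G) (ω := ω) ((kept C M)ᶜ).toList p.support
    fun s hs => by
      obtain ⟨w, hw⟩ := hN s
      obtain ⟨x, hx, hxs⟩ := exists_minWeight (ω := ω) hw
      exact ⟨x, (hp x).2 (mem_kept_of_adj hC ((hD s).1 hs) hx), hx, hxs⟩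
  obtain ⟨P, hP, hPw⟩ := hm.exists_walk p rfl
  have hPm : ∀ x, x ∈ P.support := fun x => by
    rw [hP, hm.mem_iff, hp, hD]
    exact em _
  refine ⟨c, P, ⟨hPm, fun u q hq => ?_⟩, fun s hs => ?_⟩
  · rw [hPw, Finset.sum_map_toList]
    exact hpw.trans (hQ.2 u q hq)
  · refine traversesByLoops_of_support P (cover_subset_kept C M hc) hs (hPm s) fun a b hab => ?_
    refine hm.loops_only (K := (kept C M : Set V))
      (fun s hs w hw => mem_kept_of_adj hC ((hD s).1 hs) hw) ?_ a s b hs (hP ▸ hab)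
    intro a x b hx hi
    exact absurd ((hp x).1 (hi.subset (by simp))) hx

/-- A walk of the reduced graph, as a walk of `G`. -/
abbrev includeWalk {K : Finset V} {u v : (K : Set V)} (p : (reducedGraph G K).Walk u v) :
    G.Walk u.val v.val :=
  p.map (SimpleGraph.Embedding.induce (K : Set V)).toHom

theorem support_includeWalk {K : Finset V} {u v : (K : Set V)}
    (p : (reducedGraph G K).Walk u v) :
    (includeWalk p).support = p.support.map Subtype.val :=
  SimpleGraph.Walk.support_map ..

theorem walkWeight_includeWalk {K : Finset V} {u v : (K : Set V)}
    (p : (reducedGraph G K).Walk u v) :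
    walkWeight ω (includeWalk p) = walkWeight (reducedWeight ω K) p := by
  have h : (includeWalk p).edges = p.edges.map (Sym2.map Subtype.val) :=
    SimpleGraph.Walk.edges_map ..
  rw [walkWeight, walkWeight, h, List.map_map]
  rfl

theorem walkWeight_of_subsingleton [Subsingleton V] {u v : V} (p : G.Walk u v) :
    walkWeight ω p = 0 := by
  cases p with
  | nil => rfl
  | cons h p => exact absurd (Subsingleton.elim _ _) h.ne

/-- Adding loops of total weight `2 * ∑ minWeight` preserves approximate tours, since an optimal
tour of `G` exceeds one of the reduced graph by at least this weight. -/
theorem IsApproxTour.lift [Fintype V] [DecidableEq V] {M : Finset ((V × V) × V)}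
    (hG : G.Connected) (hC : G.IsVertexCover (C : Set V))
    (hM : IsMinCostMaxHopMatching G ω C M) {u : (kept C M : Set V)}
    {P' : (reducedGraph G (kept C M)).Walk u u} {v : V} {P : G.Walk v v} (hP : IsTour P)
    (hPw : walkWeight ω P = walkWeight (reducedWeight ω (kept C M)) P' +
      2 * ∑ s ∈ (kept C M)ᶜ, minWeight G ω s) {α : ℝ} (hα : 1 ≤ α)
    (h : IsApproxTour (reducedWeight ω (kept C M)) α P') : IsApproxTour ω α P := by
  refine ⟨hP, fun x Q hQ => ?_⟩
  -- A single vertex has no incident edge, so the cover may be empty and there is no base vertex for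
  -- a route; but then all walks have weight `0`.
  cases subsingleton_or_nontrivial V with
  | inl _ => simp [walkWeight_of_subsingleton]
  | inr _ =>
    have hN := exists_adj_of_connected hG
    obtain ⟨w, hw⟩ := hN x
    obtain ⟨c, hc⟩ : ∃ c, c ∈ C := (hC hw).elim (fun h => ⟨_, h⟩) fun h => ⟨_, h⟩
    obtain ⟨p, hp, hpw⟩ := exists_walk_on_kept hC hM hN hc Q hQ
    have hpK : ∀ y ∈ p.support, y ∈ (kept C M : Set V) := fun y hy => (hp y).1 hy
    let q : (reducedGraph G (kept C M)).Walk _ _ := p.induce (kept C M : Set V) hpK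
    have hq : includeWalk q = p := p.map_induce hpK
    have hqt : IsTour q := by
      intro y
      have := (hp y.1).2 y.2
      rw [← hq, support_includeWalk, List.mem_map] at this
      obtain ⟨z, hz, hzy⟩ := this
      exact Subtype.ext hzy ▸ hz
    have h1 := h.2 _ q hqt
    rw [← walkWeight_includeWalk q, hq] at h1
    rw [hPw]
    have h2 : (walkWeight ω p : ℝ) + 2 * ((∑ s ∈ (kept C M)ᶜ, minWeight G ω s : ℕ) : ℝ) ≤
        walkWeight ω Q := by exact_mod_cast hpw
    have h3 : (0 : ℝ) ≤ ((∑ s ∈ (kept C M)ᶜ, minWeight G ω s : ℕ) : ℝ) := Nat.cast_nonneg _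
    push_cast at h1 h2 h3 ⊢
    nlinarith

end Kernel

/-! ### Verification of machine programs -/

section Hoare

/-- Started in `σ`, the program `c` halts within `T` steps in a state that satisfies `Q`. -/
def Halts (c : Prog) (σ : State) (T : ℕ) (Q : State → Prop) : Prop :=
  ∃ (σ' : State) (t : ℕ), Runs c σ σ' t ∧ t ≤ T ∧ Q σ'

theorem Halts.mono {c : Prog} {σ : State} {T T' : ℕ} {Q Q' : State → Prop} (h : Halts c σ T Q)
    (hT : T ≤ T') (hQ : ∀ σ', Q σ' → Q' σ') : Halts c σ T' Q' :=
  let ⟨σ', t, h1, h2, h3⟩ := h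
  ⟨σ', t, h1, h2.trans hT, hQ σ' h3⟩

theorem Halts.seq {c d : Prog} {σ : State} {T₁ T₂ : ℕ} {R Q : State → Prop} (h : Halts c σ T₁ R)
    (h' : ∀ σ₁, R σ₁ → Halts d σ₁ T₂ Q) : Halts (.seq c d) σ (T₁ + T₂) Q :=
  let ⟨σ₁, _, h1, h2, h3⟩ := h
  let ⟨σ₂, _, h4, h5, h6⟩ := h' σ₁ h3
  ⟨σ₂, _, .seq h1 h4, Nat.add_le_add h2 h5, h6⟩

theorem Halts.ite {c d : Prog} {x : ℕ} {σ : State} {T : ℕ} {Q : State → Prop}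
    (h : σ.reg x ≠ 0 → Halts c σ T Q) (h' : σ.reg x = 0 → Halts d σ T Q) :
    Halts (.ite x c d) σ (T + 1) Q := by
  by_cases hx : σ.reg x = 0
  · obtain ⟨σ', t, h1, h2, h3⟩ := h' hx
    exact ⟨σ', t + 1, .ite_false hx h1, Nat.succ_le_succ h2, h3⟩
  · obtain ⟨σ', t, h1, h2, h3⟩ := h hx
    exact ⟨σ', t + 1, .ite_true hx h1, Nat.succ_le_succ h2, h3⟩

/-- A loop whose register `x` counts down to zero, with the invariant `I k` when `k` rounds are
left. -/
theorem Halts.loop {c : Prog} {x T : ℕ} (I : ℕ → State → Prop) (hI : ∀ k σ, I k σ → σ.reg x = k)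
    (hc : ∀ k σ, I (k + 1) σ → Halts c σ T (I k)) (k : ℕ) (σ : State) (h : I k σ) :
    Halts (.loop x c) σ (k * (T + 1) + 1) (I 0) := by
  induction k generalizing σ with
  | zero => exact ⟨σ, 1, .loop_done (hI 0 σ h), by omega, h⟩
  | succ k ih =>
    obtain ⟨σ₁, t₁, h1, h2, h3⟩ := hc k σ h
    obtain ⟨σ₂, t₂, h4, h5, h6⟩ := ih σ₁ h3
    refine ⟨σ₂, t₁ + t₂ + 1, .loop_step (by rw [hI _ _ h]; omega) h1 h4, ?_, h6⟩
    rw [Nat.succ_mul]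
    omega

/-- Programs without loops. -/
def Prog.LoopFree : Prog → Prop
  | .seq c d => c.LoopFree ∧ d.LoopFree
  | .ite _ c d => c.LoopFree ∧ d.LoopFree
  | .loop _ _ => False
  | _ => True

/-- The final state of a loop-free program (loops are ignored). -/
def Prog.eval : Prog → State → State
  | .skip, σ => σ
  | .const r k, σ => σ.setReg r k
  | .add r x y, σ => σ.setReg r (σ.reg x + σ.reg y)
  | .sub r x y, σ => σ.setReg r (σ.reg x - σ.reg y)
  | .load r a i, σ => σ.setReg r (σ.arr a (σ.reg i))
  | .store a i x, σ => σ.setArr a (σ.reg i) (σ.reg x)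
  | .seq c d, σ => d.eval (c.eval σ)
  | .ite x c d, σ => if σ.reg x = 0 then d.eval σ else c.eval σ
  | .loop _ _, σ => σ

/-- A bound on the number of steps of a loop-free program. -/
def Prog.steps : Prog → ℕ
  | .seq c d => c.steps + d.steps
  | .ite _ c d => max c.steps d.steps + 1
  | _ => 1

theorem Halts.of_loopFree {c : Prog} (hc : c.LoopFree) (σ : State) :
    Halts c σ c.steps fun σ' => σ' = c.eval σ := by
  induction c generalizing σ with
  | skip => exact ⟨_, _, .skip σ, le_rfl, rfl⟩
  | const r k => exact ⟨_, _, .const r k σ, le_rfl, rfl⟩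
  | add r x y => exact ⟨_, _, .add r x y σ, le_rfl, rfl⟩
  | sub r x y => exact ⟨_, _, .sub r x y σ, le_rfl, rfl⟩
  | load r a i => exact ⟨_, _, .load r a i σ, le_rfl, rfl⟩
  | store a i x => exact ⟨_, _, .store a i x σ, le_rfl, rfl⟩
  | seq c d ihc ihd =>
    refine (ihc hc.1 σ).seq ?_
    rintro _ rfl
    exact ihd hc.2 _
  | ite x c d ihc ihd =>
    refine Halts.ite (fun hx => ?_) fun hx => ?_
    · exact (ihc hc.1 σ).mono (le_max_left _ _) fun σ' h => by rw [h, Prog.eval, if_neg hx]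
    · exact (ihd hc.2 σ).mono (le_max_right _ _) fun σ' h => by rw [h, Prog.eval, if_pos hx]
  | loop x c => exact hc.elim

theorem State.setReg_reg (σ : State) (r k x : ℕ) :
    (σ.setReg r k).reg x = if x = r then k else σ.reg x := by
  simp [State.setReg, Function.update_apply]

theorem State.setReg_arr (σ : State) (r k : ℕ) : (σ.setReg r k).arr = σ.arr := rfl

theorem State.setArr_reg (σ : State) (a i k : ℕ) : (σ.setArr a i k).reg = σ.reg := rfl

theorem State.setArr_arr (σ : State) (a i k b j : ℕ) :
    (σ.setArr a i k).arr b j = if b = a ∧ j = i then k else σ.arr b j := by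
  by_cases hb : b = a
  · subst hb
    simp [State.setArr, Function.update_apply]
  · simp [State.setArr, hb]

theorem State.ite_reg (p : Prop) [Decidable p] (σ τ : State) (r : ℕ) :
    (if p then σ else τ).reg r = if p then σ.reg r else τ.reg r := by
  split_ifs <;> rfl

theorem State.ite_arr (p : Prop) [Decidable p] (σ τ : State) :
    (if p then σ else τ).arr = if p then σ.arr else τ.arr := by
  split_ifs <;> rfl

theorem State.output_eq_of_eq {σ σ' : State} (h : σ'.reg 0 = σ.reg 0)
    (h' : ∀ j, σ'.arr 0 j = σ.arr 0 j) : σ'.output = σ.output := by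
  rw [State.output, State.output, h]
  exact List.map_congr_left fun j _ => h' j

theorem State.output_snoc {σ σ' : State} {x : ℕ} (h : σ'.reg 0 = σ.reg 0 + 1)
    (h' : ∀ j < σ.reg 0, σ'.arr 0 j = σ.arr 0 j) (hx : σ'.arr 0 (σ.reg 0) = x) :
    σ'.output = σ.output ++ [x] := by
  rw [State.output, State.output, h, List.range_succ, List.map_append, List.map_singleton, hx]
  exact congrArg (· ++ [x]) (List.map_congr_left fun j hj => h' j (List.mem_range.1 hj))

end Hoare

/-! ### The program of the lifting algorithm -/

section LiftProgram

/-- Writing `rᵢ` for the contents of register `i`: compares the entry of the adjacency matrix in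
cell `r₁₃` with the entry `r₁₁`, and clears the flag `r₁₆` if the former is nonzero and smaller. -/
def compareEntry : Prog :=
  .seq (.load 14 1 13) <| .seq
    (.ite 14 (.seq (.sub 15 11 14) (.ite 15 (.const 16 0) .skip)) .skip) <|
    .seq (.add 13 13 5) (.sub 12 12 5)

/-- Sets `r₁₁` to the entry in column `r₆` of the row that starts in cell `r₉`, and prepares the
scan of this row. -/
def startTest : Prog :=
  .seq (.add 10 9 6) <| .seq (.load 11 1 10) <| .seq (.add 16 11 17) <| .seq (.add 13 9 17)
    (.add 12 2 17)

/-- Sets the flag `r₁₆` to a nonzero value if and only if the entry in column `r₆` is a smallest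
nonzero entry of the row that starts in cell `r₉`. -/
def testCheapest : Prog :=
  .seq startTest (.loop 12 compareEntry)

/-- Appends the vertices `r₈` and `r₆` to the output, and marks `r₈` as present. -/
def emitLoop : Prog :=
  .seq (.store 0 0 8) <| .seq (.add 0 0 5) <| .seq (.store 0 0 6) <| .seq (.add 0 0 5)
    (.store 2 8 5)

/-- Moves on to the next vertex and the next row of the adjacency matrix. -/
def nextVertex : Prog :=
  .seq (.add 8 8 5) <| .seq (.add 9 9 2) (.sub 7 7 5)

/-- Adds a loop from `r₆` to the vertex `r₈` to the output if `r₈` is not yet present and `r₆` is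
a neighbor of `r₈` at minimum weight. -/
def tryVertex : Prog :=
  .seq (.load 10 2 8) <| .seq
    (.ite 10 .skip (.seq testCheapest (.ite 16 emitLoop .skip)))
    nextVertex

/-- Appends the next vertex `r₆` of the given tour to the output, and prepares the scan of all
vertices. -/
def copyVertex : Prog :=
  .seq (.load 6 3 4) <| .seq (.store 0 0 6) <| .seq (.add 0 0 5) <| .seq (.const 8 0) <|
    .seq (.const 9 0) (.add 7 2 17)

/-- Handles the next vertex of the given tour. -/
def copyAndLoop : Prog :=
  .seq copyVertex <| .seq (.loop 7 tryVertex) (.seq (.add 4 4 5) (.sub 3 3 5))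

/-- The lifting algorithm: copy the given tour to the output, and add after each vertex `v` loops
to all vertices that are not yet present and for which `v` is a cheapest neighbor.  Register `5`
holds `1`, and register `17` holds `0`. -/
def liftProg : Prog :=
  .seq (.const 5 1) (.loop 3 copyAndLoop)

/-- Only the registers `10` to `16` differ. -/
def SameOutsideTest (σ σ' : State) : Prop :=
  σ'.arr = σ.arr ∧ ∀ r, r < 10 ∨ 16 < r → σ'.reg r = σ.reg r

theorem halts_testCheapest {σ : State} (h5 : σ.reg 5 = 1) (h17 : σ.reg 17 = 0) :
    Halts testCheapest σ (9 * σ.reg 2 + 6) fun σ' => SameOutsideTest σ σ' ∧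
      (σ'.reg 16 ≠ 0 ↔ σ.arr 1 (σ.reg 9 + σ.reg 6) ≠ 0 ∧ ∀ x < σ.reg 2,
        σ.arr 1 (σ.reg 9 + x) = 0 ∨
          σ.arr 1 (σ.reg 9 + σ.reg 6) ≤ σ.arr 1 (σ.reg 9 + x)) := by
  set a := σ.arr 1 (σ.reg 9 + σ.reg 6) with ha
  let I : ℕ → State → Prop := fun k σ' => SameOutsideTest σ σ' ∧ σ'.reg 12 = k ∧ k ≤ σ.reg 2 ∧
    σ'.reg 13 = σ.reg 9 + (σ.reg 2 - k) ∧ σ'.reg 11 = a ∧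
    (σ'.reg 16 ≠ 0 ↔ a ≠ 0 ∧ ∀ x < σ.reg 2 - k, σ.arr 1 (σ.reg 9 + x) = 0 ∨
      a ≤ σ.arr 1 (σ.reg 9 + x))
  have hloop := Halts.loop (c := compareEntry) (x := 12) (T := 8) I (fun k σ' h => h.2.1) (by
    rintro k σ' ⟨⟨h1, h2⟩, h3, h4, h6, h7, h8⟩
    refine (Halts.of_loopFree (by simp [compareEntry, Prog.LoopFree]) σ').mono
      (by simp [compareEntry, Prog.steps]) ?_
    rintro _ rfl
    have e5 : σ'.reg 5 = 1 := by rw [h2 5 (by norm_num), h5]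
    have hk : σ.reg 2 - k = σ.reg 2 - (k + 1) + 1 := by omega
    set m := σ.reg 2 - (k + 1) with hm
    have hiff : (a ≠ 0 ∧ ∀ x < m + 1, σ.arr 1 (σ.reg 9 + x) = 0 ∨ a ≤ σ.arr 1 (σ.reg 9 + x)) ↔
        σ'.reg 16 ≠ 0 ∧ (σ.arr 1 (σ.reg 9 + m) = 0 ∨ a ≤ σ.arr 1 (σ.reg 9 + m)) := by
      rw [h8, and_assoc, and_congr_right_iff]
      intro _
      constructor
      · exact fun h => ⟨fun x hx => h x (by omega), h m (by omega)⟩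
      · rintro ⟨h, h'⟩ x hx
        rcases Nat.lt_succ_iff_lt_or_eq.1 hx with hx | rfl
        · exact h x hx
        · exact h'
    simp only [I, hk, hiff]
    refine ⟨⟨?_, ?_⟩, ?_, by omega, ?_, ?_, ?_⟩
    · simp [compareEntry, Prog.eval, State.setReg_arr, State.ite_arr, h1]
    · intro r hr
      rw [← h2 r hr]
      simp only [compareEntry, Prog.eval, State.setReg_reg, State.ite_reg]
      have : r ≠ 12 ∧ r ≠ 13 ∧ r ≠ 14 ∧ r ≠ 15 ∧ r ≠ 16 := by omega
      simp [this]
    · simp [compareEntry, Prog.eval, State.setReg_reg, State.ite_reg, h3, e5]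
    · simp [compareEntry, Prog.eval, State.setReg_reg, State.ite_reg, h6, e5, add_assoc]
    · simp [compareEntry, Prog.eval, State.setReg_reg, State.ite_reg, h7]
    · simp only [compareEntry, Prog.eval, State.setReg_reg, State.ite_reg, h6, h7,
        h1]
      simp only [Nat.reduceEqDiff, if_true, if_false]
      split_ifs with c1 c2
      · simp [c1]
      · exact (and_iff_left (Or.inr (by omega))).symm
      · simp [c1]
        omega)
  refine ((Halts.of_loopFree (c := startTest) (by simp [startTest, Prog.LoopFree]) σ).seq
    (T₂ := σ.reg 2 * 9 + 1) (Q := I 0) ?_).mono ?_ ?_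
  · rintro _ rfl
    refine hloop _ _ ⟨⟨?_, ?_⟩, ?_, le_rfl, ?_, ?_, ?_⟩
    · rfl
    · intro r hr
      simp only [startTest, Prog.eval, State.setReg_reg]
      grind
    · simp [startTest, Prog.eval, State.setReg_reg, h17]
    · simp [startTest, Prog.eval, State.setReg_reg, h17]
    · simp [startTest, Prog.eval, State.setReg_reg, State.setReg_arr, ha]
    · simp [startTest, Prog.eval, State.setReg_reg, State.setReg_arr, ha, h17]
  · simp only [startTest, Prog.steps]
    omega
  · rintro σ' ⟨h1, -, -, -, -, h2⟩
    exact ⟨h1, by simpa using h2⟩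

end LiftProgram

/-! ### The lifting algorithm -/

section LiftCorrect

variable {n : ℕ} {G : SimpleGraph (Fin n)} {ω : Sym2 (Fin n) → ℕ}

theorem getD_flatMap {α β : Type*} {f : α → List β} (hf : ∀ a, (f a).length = n) (d : β)
    (l : List α) (i : ℕ) (hi : i < l.length) {j : ℕ} (hj : j < n) :
    (l.flatMap f).getD (i * n + j) d = (f l[i]).getD j d := by
  induction l generalizing i with
  | nil => simp at hi
  | cons a l ih =>
    rw [List.flatMap_cons]
    cases i with
    | zero =>
      rw [Nat.zero_mul, Nat.zero_add, List.getD_append _ _ _ _ (by rw [hf]; exact hj)]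
      rfl
    | succ i =>
      rw [List.getD_append_right _ _ _ _ (by rw [hf, Nat.succ_mul]; omega), hf,
        show (i + 1) * n + j - n = i * n + j by rw [Nat.succ_mul]; omega,
        ih i (Nat.lt_of_succ_lt_succ hi)]
      rfl

open Classical in
theorem encodeGraph_getD (i j : Fin n) :
    (encodeGraph G ω).getD (i * n + j) 0 = if G.Adj i j then ω s(i, j) + 1 else 0 := by
  rw [encodeGraph, getD_flatMap (by simp) 0 _ _ (by simp) j.2]
  simp [List.getD_eq_getElem?_getD]

open Classical in
theorem encodeKept_getD (K : Finset (Fin n)) (i : Fin n) :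
    (encodeKept K).getD i 0 = if i ∈ K then 1 else 0 := by
  simp [encodeKept, List.getD_eq_getElem?_getD]

/-- `{s, w}` is a cheapest edge at `s`. -/
def IsCheapest (G : SimpleGraph (Fin n)) (ω : Sym2 (Fin n) → ℕ) (s w : Fin n) : Prop :=
  G.Adj s w ∧ ω s(s, w) = minWeight G ω s

/-- The comparison of the entries of a row of the weighted adjacency matrix recognizes the cheapest
edges. -/
theorem isCheapest_iff_entries (f : ℕ → ℕ) (s v : Fin n)
    (hf : ∀ x : Fin n, f x = (encodeGraph G ω).getD (s * n + x) 0) :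
    (f v ≠ 0 ∧ ∀ x < n, f x = 0 ∨ f v ≤ f x) ↔ IsCheapest G ω s v := by
  simp only [encodeGraph_getD] at hf
  have h0 : f v ≠ 0 ↔ G.Adj s v := by rw [hf]; split_ifs <;> simp [*]
  rw [h0, IsCheapest, and_congr_right_iff]
  intro hv
  have hfv : f v = ω s(s, v) + 1 := by rw [hf, if_pos hv]
  constructor
  · intro h
    refine le_antisymm ?_ (minWeight_le hv)
    obtain ⟨w, hw, hws⟩ := exists_minWeight (ω := ω) hv
    have := h w w.2
    rw [hf w, if_pos hw, hfv] at this
    omega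
  · intro h x hx
    have hfx := hf ⟨x, hx⟩
    by_cases ha : G.Adj s ⟨x, hx⟩
    · rw [if_pos ha] at hfx
      have := minWeight_le (ω := ω) ha
      right
      simp only at hfx
      omega
    · rw [if_neg ha] at hfx
      exact Or.inl hfx

/-- State of the lifting algorithm after the vertices in `l` have been copied: `o` has been written,
the vertices in `D` have got their loops, and these include all the vertices outside `K` that
belong to `T`. -/
structure Lifted (G : SimpleGraph (Fin n)) (ω : Sym2 (Fin n) → ℕ) (K : Finset (Fin n))
    (l : List (Fin n)) (T : Set (Fin n)) (o D : List (Fin n)) : Prop where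
  adds : AddsCheapestLoops G ω l D o
  nodup : D.Nodup
  notMem : ∀ s ∈ D, s ∉ K
  covered : ∀ s ∈ T, s ∉ K → s ∈ D

variable {K : Finset (Fin n)} {l o D : List (Fin n)} {T : Set (Fin n)}

theorem Lifted.snoc (h : Lifted G ω K l T o D) (v : Fin n) :
    Lifted G ω K (l ++ [v]) T (o ++ [v]) D :=
  ⟨h.adds.append_right [v], h.nodup, h.notMem, h.covered⟩

theorem Lifted.mono (h : Lifted G ω K l T o D) {T' : Set (Fin n)}
    (hT : ∀ s ∈ T', s ∉ K → s ∈ T ∨ s ∈ D) : Lifted G ω K l T' o D :=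
  ⟨h.adds, h.nodup, h.notMem, fun s hs hsK => (hT s hs hsK).elim (h.covered s · hsK) id⟩

theorem Lifted.addLoop {v s : Fin n} (h : Lifted G ω K l T (o ++ [v]) D) (hs : IsCheapest G ω s v)
    (hsK : s ∉ K) (hsD : s ∉ D) : Lifted G ω K l T (o ++ [v] ++ [s] ++ [v]) (D ++ [s]) := by
  refine ⟨h.adds.trans ?_, ?_, ?_, ?_⟩
  · have := AddsCheapestLoops.cons (G := G) (ω := ω) o [] v s [] _ hs.1 hs.2 (.nil _)
    simpa using this
  · rw [List.nodup_append]
    refine ⟨h.nodup, List.nodup_singleton s, ?_⟩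
    rintro x hx y hy rfl
    rw [List.mem_singleton] at hy
    exact hsD (hy ▸ hx)
  · intro x hx
    rcases List.mem_append.1 hx with hx | hx
    · exact h.notMem x hx
    · rw [List.mem_singleton] at hx
      exact hx ▸ hsK
  · exact fun x hx hxK => List.mem_append_left _ (h.covered x hx hxK)

/-- The contents of the memory: the input in arrays `1` and `3`, the output `o`, the constants in
the registers `2`, `5`, `17`, and in array `2` the characteristic vector of `K` and `D`. -/
structure Memory (G : SimpleGraph (Fin n)) (ω : Sym2 (Fin n) → ℕ) (K : Finset (Fin n))
    (p : List (Fin n)) (o D : List (Fin n)) (σ : State) : Prop where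
  size : σ.reg 2 = n
  one : σ.reg 5 = 1
  zero : σ.reg 17 = 0
  graph : ∀ i, σ.arr 1 i = (encodeGraph G ω).getD i 0
  tour : ∀ i (h : i < p.length), σ.arr 3 i = p[i]
  output : σ.output = o.map Fin.val
  present : ∀ s : Fin n, σ.arr 2 s = 0 ↔ s ∉ K ∧ s ∉ D

theorem Memory.of_eq {p : List (Fin n)} {σ σ' : State} (h : Memory G ω K p o D σ)
    (h0 : σ'.reg 0 = σ.reg 0) (h2 : σ'.reg 2 = σ.reg 2) (h5 : σ'.reg 5 = σ.reg 5)
    (h17 : σ'.reg 17 = σ.reg 17) (ha : σ'.arr = σ.arr) : Memory G ω K p o D σ' where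
  size := h2.trans h.size
  one := h5.trans h.one
  zero := h17.trans h.zero
  graph := by rw [ha]; exact h.graph
  tour := by rw [ha]; exact h.tour
  output := (State.output_eq_of_eq h0 fun j => by rw [ha]).trans h.output
  present := by rw [ha]; exact h.present

theorem eval_emitLoop {p : List (Fin n)} {σ : State} (h : Memory G ω K p o D σ) {s v : Fin n}
    (h8 : σ.reg 8 = s) (h6 : σ.reg 6 = v) :
    Memory G ω K p (o ++ [s] ++ [v]) (D ++ [s]) (emitLoop.eval σ) ∧
      ∀ r ≠ 0, (emitLoop.eval σ).reg r = σ.reg r := by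
  have hreg : ∀ r ≠ 0, (emitLoop.eval σ).reg r = σ.reg r := by
    intro r hr
    simp [emitLoop, Prog.eval, State.setReg_reg, State.setArr_reg, hr]
  refine ⟨⟨?_, ?_, ?_, ?_, ?_, ?_, ?_⟩, hreg⟩
  · rw [hreg 2 (by norm_num), h.size]
  · rw [hreg 5 (by norm_num), h.one]
  · rw [hreg 17 (by norm_num), h.zero]
  · intro i
    simp [emitLoop, Prog.eval, State.setReg_arr, State.setArr_arr, h.graph]
  · intro i hi
    simp [emitLoop, Prog.eval, State.setReg_arr, State.setArr_arr, h.tour i hi]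
  · -- The state after the first of the two vertices has been written.
    let τ : State := (Prog.seq (.store 0 0 8) (.add 0 0 5)).eval σ
    have hτ : τ.output = σ.output ++ [s.val] := by
      apply State.output_snoc
      · simp [τ, Prog.eval, State.setReg_reg, State.setArr_reg, h.one]
      · intro j hj
        simp [τ, Prog.eval, State.setReg_arr, State.setArr_arr, hj.ne]
      · simp [τ, Prog.eval, State.setReg_arr, State.setArr_arr, h8]
    have h0 : τ.reg 0 = σ.reg 0 + 1 := by
      simp [τ, Prog.eval, State.setReg_reg, State.setArr_reg, h.one]
    have : (emitLoop.eval σ).output = τ.output ++ [v.val] := by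
      apply State.output_snoc
      · rw [h0]
        simp [emitLoop, Prog.eval, State.setReg_reg, State.setArr_reg, h.one]
      · intro j hj
        rw [h0] at hj
        simp [emitLoop, τ, Prog.eval, State.setReg_reg, State.setArr_reg, State.setReg_arr,
          State.setArr_arr, h.one, hj.ne]
      · simp [emitLoop, h0, Prog.eval, State.setReg_reg, State.setArr_reg, State.setReg_arr,
          State.setArr_arr, h.one, h6]
    rw [this, hτ, h.output]
    simp
  · intro x
    have := h.present x
    simp only [emitLoop, Prog.eval, State.setReg_reg, State.setArr_reg, State.setReg_arr,
      State.setArr_arr, h.one, h8, List.mem_append, List.mem_singleton]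
    by_cases hx : x = s
    · simp [hx]
    · simp [hx, Fin.val_inj, this]

theorem halts_tryVertex {p : List (Fin n)} {σ : State} (h : Memory G ω K p o D σ) {o' : List (Fin n)}
    {s v : Fin n} (ho : o = o' ++ [v]) (hl : Lifted G ω K l T o D) (h8 : σ.reg 8 = s)
    (h9 : σ.reg 9 = s * n) (h6 : σ.reg 6 = v) :
    Halts tryVertex σ (9 * n + 18) fun σ' => ∃ o₁ D₁ o₁', Memory G ω K p o₁ D₁ σ' ∧
      o₁ = o₁' ++ [v] ∧ Lifted G ω K l (T ∪ {x | x = s ∧ IsCheapest G ω s v}) o₁ D₁ ∧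
      σ'.reg 3 = σ.reg 3 ∧ σ'.reg 4 = σ.reg 4 ∧ σ'.reg 6 = σ.reg 6 ∧
      σ'.reg 7 = σ.reg 7 - 1 ∧ σ'.reg 8 = σ.reg 8 + 1 ∧ σ'.reg 9 = σ.reg 9 + n := by
  let R : State → Prop := fun σ' => ∃ o₁ D₁ o₁', Memory G ω K p o₁ D₁ σ' ∧
      o₁ = o₁' ++ [v] ∧ Lifted G ω K l (T ∪ {x | x = s ∧ IsCheapest G ω s v}) o₁ D₁ ∧
      ∀ r, r ≠ 0 → (r < 10 ∨ 16 < r) → σ'.reg r = σ.reg r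
  have hload := Halts.of_loopFree (c := .load 10 2 8) (by simp [Prog.LoopFree]) σ
  have hnext : ∀ σ', R σ' → Halts nextVertex σ' 3 fun σ' => ∃ o₁ D₁ o₁', Memory G ω K p o₁ D₁ σ' ∧
      o₁ = o₁' ++ [v] ∧ Lifted G ω K l (T ∪ {x | x = s ∧ IsCheapest G ω s v}) o₁ D₁ ∧
      σ'.reg 3 = σ.reg 3 ∧ σ'.reg 4 = σ.reg 4 ∧ σ'.reg 6 = σ.reg 6 ∧
      σ'.reg 7 = σ.reg 7 - 1 ∧ σ'.reg 8 = σ.reg 8 + 1 ∧ σ'.reg 9 = σ.reg 9 + n := by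
    rintro σ' ⟨o₁, D₁, o₁', h1, h2, h3, h4⟩
    refine (Halts.of_loopFree (by simp [nextVertex, Prog.LoopFree]) σ').mono
      (by simp [nextVertex, Prog.steps]) ?_
    rintro _ rfl
    refine ⟨o₁, D₁, o₁', h1.of_eq ?_ ?_ ?_ ?_ ?_, h2, h3, ?_⟩
    · simp [nextVertex, Prog.eval, State.setReg_reg]
    · simp [nextVertex, Prog.eval, State.setReg_reg]
    · simp [nextVertex, Prog.eval, State.setReg_reg]
    · simp [nextVertex, Prog.eval, State.setReg_reg]
    · simp [nextVertex, Prog.eval, State.setReg_arr]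
    · simp [nextVertex, Prog.eval, State.setReg_reg, h1.one, h1.size, h4]
  refine (hload.seq (T₂ := (9 * n + 6 + (5 + 1) + 1) + 3) fun σ₁ h₁ => ?_).mono
    (by simp [Prog.steps]; omega) fun _ h => h
  subst h₁
  set σ₁ := (Prog.load 10 2 8).eval σ with hσ₁
  have hr : ∀ r ≠ 10, σ₁.reg r = σ.reg r := fun r hr => by
    simp [hσ₁, Prog.eval, State.setReg_reg, hr]
  have h10 : σ₁.reg 10 = σ.arr 2 s := by simp [hσ₁, Prog.eval, State.setReg_reg, h8]
  have hm : Memory G ω K p o D σ₁ :=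
    h.of_eq (hr _ (by norm_num)) (hr _ (by norm_num)) (hr _ (by norm_num)) (hr _ (by norm_num)) rfl
  refine Halts.seq (R := R) (Halts.ite (fun hx => ?_) fun hx => ?_) hnext
  · refine (Halts.of_loopFree (c := .skip) trivial σ₁).mono (by simp [Prog.steps]) ?_
    rintro _ rfl
    refine ⟨o, D, o', hm, ho, hl.mono ?_, fun r _ hr' => hr r (by omega)⟩
    rintro x (hx' | ⟨rfl, -⟩) hxK
    · exact Or.inl hx'
    · rw [h10, Ne, h.present] at hx
      tauto
  · rw [h10, h.present] at hx
    have htest := halts_testCheapest hm.one hm.zero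
    rw [hm.size] at htest
    refine (htest.seq (T₂ := 5 + 1) ?_).mono (by omega) fun _ h => h
    rintro σ₂ ⟨⟨ha, hr₂⟩, h16⟩
    rw [hr 9 (by norm_num), hr 6 (by norm_num), h9, h6,
      isCheapest_iff_entries (fun x => σ₁.arr 1 (s * n + x)) s v fun x => hm.graph _] at h16
    have hm₂ : Memory G ω K p o D σ₂ :=
      hm.of_eq (hr₂ _ (by norm_num)) (hr₂ _ (by norm_num)) (hr₂ _ (by norm_num))
        (hr₂ _ (by norm_num)) ha
    have hreg : ∀ r, r ≠ 0 → (r < 10 ∨ 16 < r) → σ₂.reg r = σ.reg r := fun r _ hr' => by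
      rw [hr₂ r hr', hr r (by omega)]
    refine Halts.ite (fun hc => ?_) fun hc => ?_
    · refine (Halts.of_loopFree (by simp [emitLoop, Prog.LoopFree]) σ₂).mono
        (by simp [emitLoop, Prog.steps]) ?_
      rintro _ rfl
      obtain ⟨h1, h2⟩ := eval_emitLoop hm₂ ((hreg 8 (by norm_num) (by norm_num)).trans h8)
        ((hreg 6 (by norm_num) (by norm_num)).trans h6)
      refine ⟨_, _, _, h1, rfl, ?_, fun r h0 hr' => (h2 r h0).trans (hreg r h0 hr')⟩
      subst ho
      refine (hl.addLoop (h16.1 hc) hx.1 hx.2).mono ?_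
      rintro x (hx' | ⟨rfl, -⟩) _
      · exact Or.inl hx'
      · exact Or.inr (by simp)
    · refine (Halts.of_loopFree (c := .skip) trivial σ₂).mono (by simp [Prog.steps]) ?_
      rintro _ rfl
      refine ⟨o, D, o', hm₂, ho, hl.mono ?_, hreg⟩
      rintro x (hx' | ⟨-, hx'⟩) _
      · exact Or.inl hx'
      · exact absurd hc (h16.2 hx')

theorem halts_copyAndLoop {p : List (Fin n)} {σ : State} (h : Memory G ω K p o D σ) {i : ℕ}
    (hi : i < p.length) (hl : Lifted G ω K l T o D) (h4 : σ.reg 4 = i) :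
    Halts copyAndLoop σ (n * (9 * n + 18 + 1) + 9) fun σ' => ∃ o₁ D₁, Memory G ω K p o₁ D₁ σ' ∧
      Lifted G ω K (l ++ [p[i]]) (T ∪ {x | IsCheapest G ω x p[i]}) o₁ D₁ ∧
      σ'.reg 3 = σ.reg 3 - 1 ∧ σ'.reg 4 = i + 1 := by
  set v := p[i] with hv
  let I : ℕ → State → Prop := fun k σ' => ∃ o₁ D₁ o₁', Memory G ω K p o₁ D₁ σ' ∧
    o₁ = o₁' ++ [v] ∧
    Lifted G ω K (l ++ [v]) (T ∪ {x | x.val < n - k ∧ IsCheapest G ω x v}) o₁ D₁ ∧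
    σ'.reg 3 = σ.reg 3 ∧ σ'.reg 4 = i ∧ σ'.reg 6 = v ∧
    σ'.reg 7 = k ∧ k ≤ n ∧ σ'.reg 8 = n - k ∧ σ'.reg 9 = (n - k) * n
  have hloop := Halts.loop (c := tryVertex) (x := 7) (T := 9 * n + 18) I
    (fun k σ' ⟨_, _, _, _, _, _, _, _, _, h, _⟩ => h) (by
    rintro k σ' ⟨o₁, D₁, o₁', h1, h2, h3, e3, e4, e6, e7, hk, e8, e9⟩
    let s : Fin n := ⟨n - (k + 1), by omega⟩
    have hs : n - k = s.val + 1 := by simp only [s]; omega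
    refine (halts_tryVertex h1 h2 h3 (s := s) e8 e9 e6).mono le_rfl ?_
    rintro σ'' ⟨o₂, D₂, o₂', g1, g2, g3, f3, f4, f6, f7, f8, f9⟩
    refine ⟨o₂, D₂, o₂', g1, g2, g3.mono ?_, f3.trans e3, f4.trans e4, f6.trans e6, ?_,
      by omega, ?_, ?_⟩
    · rintro x (hx | ⟨hx, hxv⟩) _
      · exact Or.inl (Or.inl (Or.inl hx))
      · rw [hs] at hx
        rcases Nat.lt_succ_iff_lt_or_eq.1 hx with hx | hx
        · exact Or.inl (Or.inl (Or.inr ⟨hx, hxv⟩))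
        · obtain rfl : x = s := Fin.ext hx
          exact Or.inl (Or.inr ⟨rfl, hxv⟩)
    · rw [f7, e7]; rfl
    · rw [f8, e8, hs]
    · rw [f9, e9, hs, Nat.succ_mul])
  refine ((Halts.of_loopFree (c := copyVertex) (by simp [copyVertex, Prog.LoopFree]) σ).seq
    (T₂ := n * (9 * n + 18 + 1) + 1 + 2) ?_).mono
    (by simp [copyVertex, Prog.steps]; omega) fun _ h => h
  rintro _ rfl
  have h6 : σ.arr 3 (σ.reg 4) = v := by rw [h4, h.tour i hi]
  refine (hloop n _ ⟨o ++ [v], D, o, ⟨?_, ?_, ?_, ?_, ?_, ?_, ?_⟩, rfl, (hl.snoc v).mono ?_, ?_, ?_,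
    ?_, ?_, le_rfl, ?_, ?_⟩).seq ?_
  · simp [copyVertex, Prog.eval, State.setReg_reg, State.setArr_reg, h.size]
  · simp [copyVertex, Prog.eval, State.setReg_reg, State.setArr_reg, h.one]
  · simp [copyVertex, Prog.eval, State.setReg_reg, State.setArr_reg, h.zero]
  · intro j
    simp [copyVertex, Prog.eval, State.setReg_arr, State.setArr_arr, h.graph]
  · intro j hj
    simp [copyVertex, Prog.eval, State.setReg_arr, State.setArr_arr, h.tour j hj]
  · rw [List.map_append, ← h.output]
    apply State.output_snoc
    · simp [copyVertex, Prog.eval, State.setReg_reg, State.setArr_reg, h.one]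
    · intro j hj
      simp [copyVertex, Prog.eval, State.setReg_reg, State.setReg_arr, State.setArr_arr, hj.ne]
    · simp [copyVertex, Prog.eval, State.setReg_reg, State.setReg_arr, State.setArr_arr, h6]
  · intro x
    simp [copyVertex, Prog.eval, State.setReg_arr, State.setArr_arr, h.present x]
  · rintro x (hx | ⟨hx, -⟩) _
    · exact Or.inl hx
    · omega
  · simp [copyVertex, Prog.eval, State.setReg_reg, State.setArr_reg]
  · simp [copyVertex, Prog.eval, State.setReg_reg, State.setArr_reg, h4]
  · simp [copyVertex, Prog.eval, State.setReg_reg, State.setArr_reg, h6]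
  · simp [copyVertex, Prog.eval, State.setReg_reg, State.setArr_reg, h.size, h.zero]
  · simp [copyVertex, Prog.eval, State.setReg_reg, State.setArr_reg]
  · simp [copyVertex, Prog.eval, State.setReg_reg, State.setArr_reg]
  · rintro σ' ⟨o₁, D₁, o₁', h1, -, h3, e3, e4, -⟩
    refine (Halts.of_loopFree (by simp [Prog.LoopFree]) σ').mono (by simp [Prog.steps]) ?_
    rintro _ rfl
    refine ⟨o₁, D₁, h1.of_eq ?_ ?_ ?_ ?_ ?_, h3.mono ?_, ?_, ?_⟩
    · simp [Prog.eval, State.setReg_reg]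
    · simp [Prog.eval, State.setReg_reg]
    · simp [Prog.eval, State.setReg_reg]
    · simp [Prog.eval, State.setReg_reg]
    · simp [Prog.eval, State.setReg_arr]
    · rintro x (hx | hx) _
      · exact Or.inl (Or.inl hx)
      · exact Or.inl (Or.inr ⟨x.2, hx⟩)
    · simp [Prog.eval, State.setReg_reg, h1.one, e3]
    · simp [Prog.eval, State.setReg_reg, h1.one, e4]

end LiftCorrect

section Correctness

variable {n : ℕ} {G : SimpleGraph (Fin n)} {ω : Sym2 (Fin n) → ℕ} {K : Finset (Fin n)}

theorem memory_initialState {u : (K : Set (Fin n))} (p : (reducedGraph G K).Walk u u) :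
    Memory G ω K (p.support.map Subtype.val) [] []
      ((initialState (liftInput G ω K p)).setReg 5 1) where
  size := by simp [State.setReg_reg, initialState, liftInput, encodeKept]
  one := by simp [State.setReg_reg]
  zero := by simp [State.setReg_reg, initialState, liftInput]
  graph i := by simp [State.setReg_arr, initialState, liftInput]
  tour i h := by
    rw [List.length_map] at h
    change (p.support.map fun v => v.val.val).getD i 0 = _
    rw [List.getD_eq_getElem _ _ (by simpa using h), List.getElem_map, List.getElem_map]
  output := by simp [State.output, State.setReg_reg, initialState]
  present s := by
    change (encodeKept K).getD s 0 = 0 ↔ _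
    rw [encodeKept_getD]
    simp

theorem length_le_sum_size (l : List ℕ) : l.length ≤ (l.map fun x => Nat.size x + 1).sum := by
  induction l with
  | nil => simp
  | cons x l ih => simp only [List.length_cons, List.map_cons, List.sum_cons]; omega

theorem le_inputSize {u : (K : Set (Fin n))} (p : (reducedGraph G K).Walk u u) :
    n + p.support.length ≤ inputSize (liftInput G ω K p) := by
  have h1 := length_le_sum_size (encodeKept K)
  have h2 := length_le_sum_size (p.support.map fun v => v.val.val)
  rw [encodeKept, List.length_map, List.length_finRange] at h1
  rw [List.length_map] at h2
  simp only [inputSize, liftInput, List.map_cons, List.map_nil, List.sum_cons, List.sum_nil]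
  unfold encodeKept
  omega

/-- The running time of the lifting algorithm, as a polynomial in the size of the input. -/
noncomputable def liftTime : Polynomial ℕ :=
  Polynomial.C 40 * (Polynomial.X + 1) ^ 3

/-- On a tour of the reduced graph, the lifting algorithm outputs the given vertex sequence with one
cheapest loop added for each vertex outside `K`, provided that the cheapest neighbors of these
vertices belong to `K`. -/
theorem computesWithin_liftProg {u : (K : Set (Fin n))} (p : (reducedGraph G K).Walk u u)
    (hp : IsTour p) (hK : ∀ s ∉ K, ∃ w ∈ K, IsCheapest G ω s w) :
    ∃ o D : List (Fin n),
      ComputesWithin liftProg (liftInput G ω K p) (o.map Fin.val)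
        (liftTime.eval (inputSize (liftInput G ω K p))) ∧
      AddsCheapestLoops G ω (p.support.map Subtype.val) D o ∧ D.Nodup ∧ ∀ s, s ∈ D ↔ s ∉ K := by
  set l : List (Fin n) := p.support.map Subtype.val with hl
  have hlen : l.length = p.support.length := List.length_map ..
  let T : ℕ → Set (Fin n) := fun i => {s | ∃ w ∈ l.take i, IsCheapest G ω s w}
  let I : ℕ → State → Prop := fun k σ => ∃ o D, Memory G ω K l o D σ ∧ σ.reg 3 = k ∧
    k ≤ l.length ∧ σ.reg 4 = l.length - k ∧
    Lifted G ω K (l.take (l.length - k)) (T (l.length - k)) o D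
  have hloop := Halts.loop (c := copyAndLoop) (x := 3) (T := n * (9 * n + 18 + 1) + 9) I
    (fun k σ ⟨_, _, _, h, _⟩ => h) (by
    rintro k σ ⟨o, D, h1, h2, h3, h4, h5⟩
    have hi : l.length - (k + 1) < l.length := by omega
    refine (halts_copyAndLoop h1 hi h5 h4).mono le_rfl ?_
    rintro σ' ⟨o', D', g1, g2, g3, g4⟩
    have hk : l.length - k = l.length - (k + 1) + 1 := by omega
    refine ⟨o', D', g1, by rw [g3, h2]; rfl, by omega, by rw [g4, hk], ?_⟩
    rw [hk, List.take_add_one, List.getElem?_eq_getElem hi, Option.toList_some]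
    refine g2.mono ?_
    rintro s ⟨w, hw, hs⟩ _
    rw [List.take_add_one, List.getElem?_eq_getElem hi, Option.toList_some, List.mem_append,
      List.mem_singleton] at hw
    rcases hw with hw | rfl
    · exact Or.inl (Or.inl ⟨w, hw, hs⟩)
    · exact Or.inl (Or.inr hs))
  have hinit : I l.length ((initialState (liftInput G ω K p)).setReg 5 1) := by
    refine ⟨[], [], memory_initialState p, ?_, le_rfl, ?_, ?_⟩
    · simp [State.setReg_reg, initialState, liftInput, hlen]
    · simp [State.setReg_reg, initialState, liftInput]
    · rw [Nat.sub_self, List.take_zero]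
      refine ⟨.nil _, List.nodup_nil, by simp, ?_⟩
      rintro s ⟨w, hw, -⟩
      simp at hw
  obtain ⟨σ, t, hrun, ht, o, D, h1, -, -, -, h5⟩ := (Halts.of_loopFree (c := .const 5 1) trivial
    (initialState (liftInput G ω K p))).seq (Q := I 0) fun σ₁ h => by
      rw [h]; exact hloop _ _ hinit
  rw [Nat.sub_zero, List.take_length] at h5
  refine ⟨o, D, ⟨σ, t, hrun, ht.trans ?_, h1.output⟩, h5.adds, h5.nodup, fun s =>
    ⟨h5.notMem s, fun hs => h5.covered s ?_ hs⟩⟩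
  · have hN := le_inputSize (ω := ω) p
    rw [← hlen] at hN
    generalize inputSize (liftInput G ω K p) = N at hN
    have hn : n ≤ N := by omega
    have hL : l.length ≤ N := by omega
    simp only [liftTime, Prog.steps, Polynomial.eval_mul, Polynomial.eval_C, Polynomial.eval_pow,
      Polynomial.eval_add, Polynomial.eval_X, Polynomial.eval_one]
    calc 1 + (l.length * (n * (9 * n + 18 + 1) + 9 + 1) + 1)
        ≤ 1 + (N * (N * (9 * N + 18 + 1) + 9 + 1) + 1) := by gcongr
      _ ≤ 40 * (N + 1) ^ 3 := by ring_nf; omega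
  · obtain ⟨w, hw, hsw⟩ := hK s hs
    refine ⟨w, ?_, hsw⟩
    rw [List.take_length, hl]
    exact List.mem_map.2 ⟨⟨w, hw⟩, hp _, rfl⟩

end Correctness
end GTSP

theorem mainTheorem2 :
    -- There is an optimal tour that traverses all deleted vertices by loops.
    (∀ (n : ℕ) (G : SimpleGraph (Fin n)) (ω : Sym2 (Fin n) → ℕ) (C : Finset (Fin n))
        (M : Finset ((Fin n × Fin n) × Fin n)),
      2 ≤ n → G.Connected → G.IsVertexCover (C : Set (Fin n)) →
      GTSP.IsMinCostMaxHopMatching G ω C M →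
      ∃ (v : Fin n) (P : G.Walk v v), GTSP.IsOptimalTour ω P ∧
        ∀ s ∉ GTSP.kept C M, GTSP.TraversesByLoops P s) ∧
    -- Tours of the reduced instance are lifted in polynomial time.
    ∃ (prog : GTSP.Prog) (poly : Polynomial ℕ),
      ∀ (n : ℕ) (G : SimpleGraph (Fin n)) (ω : Sym2 (Fin n) → ℕ) (C : Finset (Fin n))
        (M : Finset ((Fin n × Fin n) × Fin n)),
      G.Connected → G.IsVertexCover (C : Set (Fin n)) →
      GTSP.IsMinCostMaxHopMatching G ω C M →
      ∀ (u : (GTSP.kept C M : Set (Fin n)))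
        (P' : (GTSP.reducedGraph G (GTSP.kept C M)).Walk u u), GTSP.IsTour P' →
      ∃ (v : Fin n) (P : G.Walk v v),
        GTSP.ComputesWithin prog (GTSP.liftInput G ω (GTSP.kept C M) P')
          (P.support.map Fin.val)
          (poly.eval (GTSP.inputSize (GTSP.liftInput G ω (GTSP.kept C M) P'))) ∧
        GTSP.IsTour P ∧
        -- `P` is `P'` with one cheapest loop added for each deleted vertex.
        (∃ D : List (Fin n), D.Nodup ∧ (∀ s, s ∈ D ↔ s ∉ GTSP.kept C M) ∧
          GTSP.AddsCheapestLoops G ω (P'.support.map Subtype.val) D P.support) ∧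
        GTSP.walkWeight ω P =
          GTSP.walkWeight (GTSP.reducedWeight ω (GTSP.kept C M)) P' +
            2 * ∑ s ∈ (GTSP.kept C M)ᶜ, GTSP.minWeight G ω s ∧
        ∀ α : ℝ, 1 ≤ α →
          GTSP.IsApproxTour (GTSP.reducedWeight ω (GTSP.kept C M)) α P' →
          GTSP.IsApproxTour ω α P := by
  constructor
  · intro n G ω C M hn hG hC hM
    have : Nontrivial (Fin n) := Fin.nontrivial_iff_two_le.2 hn
    exact GTSP.exists_optimalTour_loops hG hC hM
  · refine ⟨GTSP.liftProg, GTSP.liftTime, fun n G ω C M hG hC hM u P' hP' => ?_⟩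
    have hK : ∀ s ∉ GTSP.kept C M, ∃ w ∈ GTSP.kept C M, GTSP.IsCheapest G ω s w := by
      intro s hs
      -- The kept vertex `u` differs from `s`, so `s` has a neighbor.
      have : Nontrivial (Fin n) := ⟨s, u.val, fun h => hs (h ▸ u.2)⟩
      obtain ⟨w, hw⟩ := GTSP.exists_adj_of_connected hG s
      obtain ⟨x, hx, hxs⟩ := GTSP.exists_minWeight (ω := ω) hw
      exact ⟨x, GTSP.mem_kept_of_adj hC hs hx, hx, hxs⟩
    obtain ⟨o, D, hcomp, hadds, hnd, hD⟩ := GTSP.computesWithin_liftProg P' hP' hK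
    obtain ⟨P, hPo, hPw⟩ := hadds.exists_walk _ (GTSP.support_includeWalk P')
    have hPt : GTSP.IsTour P := by
      intro s
      rw [hPo, hadds.mem_iff, hD]
      by_cases hs : s ∈ GTSP.kept C M
      · exact Or.inl (List.mem_map.2 ⟨⟨s, hs⟩, hP' _, rfl⟩)
      · exact Or.inr hs
    have hw : GTSP.walkWeight ω P =
        GTSP.walkWeight (GTSP.reducedWeight ω (GTSP.kept C M)) P' +
          2 * ∑ s ∈ (GTSP.kept C M)ᶜ, GTSP.minWeight G ω s := by
      have hDK : (GTSP.kept C M)ᶜ = D.toFinset := by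
        ext s
        rw [Finset.mem_compl, List.mem_toFinset, hD]
      rw [hPw, GTSP.walkWeight_includeWalk, hDK, List.sum_toFinset _ hnd]
    exact ⟨u.val, P, hPo ▸ hcomp, hPt, ⟨D, hnd, hD, hPo ▸ hadds⟩, hw,
      fun α hα h => GTSP.IsApproxTour.lift hG hC hM hPt hw hα h⟩
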